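/- All vector spaces are over $\mathbb C$. Let $(V,Y,\mathbf 1,\omega)$ be a vertex operator algebra, $V=\bigoplus_{n\in\mathbb Z}V_{(n)}$ with $\dim V_{(n)}<\infty$ and $V_{(n)}=0$ for $n\ll 0$; write $Y(a,x)=\sum_{n\in\mathbb Z}a_nx^{-n-1}$, $L(n)=\omega_{n+1}$, and $\mathrm{wt}\,a=n$ for $a\in V_{(n)}$. A *weak $V$-module* is a vector space $M$ with a linear map $Y_M:V\to(\mathrm{End}\,M)[[x,x^{-1}]]$ such that $Y_M(a,x)z\in M((x))$ for $a\in V$, $z\in M$, $Y_M(\mathbf 1,x)=1$, $Y_M(L(-1)a,x)=\frac{d}{dx}Y_M(a,x)$, and the Jacobi identity holds. It is a *$V$-module* if moreover $M=\bigoplus_{h\in\mathbb C}M_{(h)}$ with $L(0)=h$ on $M_{(h)}$, $\dim M_{(h)}<\infty$, and, for each $h$, $M_{(h+n)}=0$ for $n\in\mathbb Z$ sufficiently small. It is *$\mathbb N$-gradable* if $M=\bigoplus_{k\in\mathbb N}M(k)$ with $a_nM(k)\subseteq M(\mathrm{wt}\,a-n-1+k)$ for homogeneous $a$ (with $M(k)=0$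 for $k<0$). $V$ is *rational* if every $\mathbb N$-gradable weak $V$-module is a direct sum of irreducible $\mathbb N$-gradable weak $V$-modules. Let $g(V)$ be the Lie algebra with generators $a(n)=t^n\otimes a$ ($a\in V$, $n\in\mathbb Z$), linear in $a$, and defining relations $(L(-1)a)(n)=-n\,a(n-1)$ and $[a(m),b(n)]=\sum_{i\ge0}\binom mi(a_ib)(m+n-i)$. It is $\mathbb Z$-graded by $\deg a(n)=\mathrm{wt}\,a-n-1$; $g(V)_0$ is its degree-zero subalgebra, which is spanned by the elements $a(\mathrm{wt}\,a-1)$ and contains $L(0)=\omega(1)$. For a $g(V)_0$-module $U$, write $a_{\mathrm{wt}\,a-1}u$ for the action of $a(\mathrm{wt}\,a-1)$ on $u\in U$. For vector spaces $N,P$, let $\mathrm{Hom}(N,P)\{x\}$ be the space of formal series $\Phi(x)=\sum_{\alpha\in\mathbb C}\Phi_\alpha x^{-\alpha-1}$ with $\Phi_\alpha\in\mathrm{Hom}(N,P)$. The series $\Phi(x)$ is *truncated* if for all $\alpha\in\mathbb C$ and $z\in N$ one has $\Phi_{\alpha+n}z=0$ for $n\in\mathbb Z$ sufficiently large. For weak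 $V$-modules $W,N,P$, an *intertwining operator of type $\binom{P}{W\,N}$* is a linear map $I(\cdot,x):W\to\mathrm{Hom}(N,P)\{x\}$ such that every $I(u,x)$ is truncated, $I(L(-1)u,x)=\frac{d}{dx}I(u,x)$, and, for $a\in V$ and $u\in W$, $$x_0^{-1}\delta\Big(\tfrac{x_1-x_2}{x_0}\Big)Y_P(a,x_1)I(u,x_2)-x_0^{-1}\delta\Big(\tfrac{-x_2+x_1}{x_0}\Big)I(u,x_2)Y_N(a,x_1)=x_2^{-1}\delta\Big(\tfrac{x_1-x_0}{x_2}\Big)I(Y_W(a,x_0)u,x_2)$$ when applied to any vector of $N$. Here $(x_1-x_2)^n$ and $(-x_2+x_1)^n$, $n\in\mathbb Z$, are expanded in nonnegative powers of the second summand, and $\delta(x)=\sum_{n\in\mathbb Z}x^n$. **Theorem.** Let $W_1,W_2$ be $V$-modules and let $U$ be a $g(V)_0$-module on which $L(0)$ acts as a scalar $h\in\mathbb C$. Let $I_0(\cdot,x):U\to\mathrm{Hom}(W_1,W_2)\{x\}$ be an injective linear map such that, for every $u\in U$, $I_0(u,x)$ is truncated, $[L(-1),I_0(u,x)]=\frac{d}{dx}I_0(u,x)$,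 and, for every homogeneous $a\in V$, $$(x_1-x_2)^{\mathrm{wt}\,a-1}Y_{W_2}(a,x_1)I_0(u,x_2)-(-x_2+x_1)^{\mathrm{wt}\,a-1}I_0(u,x_2)Y_{W_1}(a,x_1)=x_1^{-1}\delta\Big(\tfrac{x_2}{x_1}\Big)I_0(a_{\mathrm{wt}\,a-1}u,x_2)$$ when applied to any vector of $W_1$. Then there is a weak $V$-module $W$ and an injective linear map $U\hookrightarrow W$, by which we regard $U$ as a subspace of $W$, with the following properties. 1. $W$ is a lowest weight weak $V$-module with lowest weight subspace $U$: for every homogeneous $a\in V$, the operator $a_{\mathrm{wt}\,a-1}$ on $W$ restricts to the given action of $a(\mathrm{wt}\,a-1)\in g(V)_0$ on $U$, and $a_nU=0$ for $n\ge\mathrm{wt}\,a$; $U$ generates $W$ as a weak $V$-module; and $W=\bigoplus_{n\in\mathbb N}W_{(h+n)}$, where $W_{(h+n)}$ is the eigenspace of $L(0)$ for $h+n$, with $W_{(h)}=U$. 2. There is exactly one intertwining operator $I(\cdot,x)$ of type $\binom{W_2}{W\,W_1}$ such that $I(u,x)=I_0(u,x)$ for all $u\in U$. 3. If $V$ is rational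 and $U$ is an irreducible $g(V)_0$-module, then $W$ is an irreducible weak $V$-module. -/

import Mathlib

/-!
Formal calculus is written in components.  For a series `A(x) = ∑ A_γ x^{-γ-1}` the coefficient
`A_γ` is called the mode of index `γ`.  An identity between formal series is stated as the family
of the identities between its coefficients.  All the sums `∑ᶠ` below have finitely many
nonzero terms, by the truncation conditions that accompany them.
-/

universe u v w

noncomputable section

/-- The Jacobi identity for one element `a` and one operator `u`,
`x₀⁻¹δ((x₁-x₂)/x₀) a(x₁)u(x₂) - x₀⁻¹δ((-x₂+x₁)/x₀) u(x₂)a(x₁) = x₂⁻¹δ((x₁-x₀)/x₂) (a(x₀)u)(x₂)`,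
applied to any `z`: the coefficients of `x₀^{-l-1} x₁^{-m-1} x₂^{-γ-1}`.
Here `aP`, `aN` are the modes of `a` on the target and on the source, `u` the modes of the
operator, and `au k` the modes of the operator attached to `a_k u`.  The operators have integral
powers of `x₂` for `Γ = ℤ` and complex powers for `Γ = ℂ`. -/
def JacobiIdentity {Γ : Type*} [Ring Γ] {N : Type*} {P : Type*}
    [AddCommGroup N] [Module ℂ N] [AddCommGroup P] [Module ℂ P]
    (aP : ℤ → Module.End ℂ P) (aN : ℤ → Module.End ℂ N)
    (u : Γ → (N →ₗ[ℂ] P)) (au : ℤ → Γ → (N →ₗ[ℂ] P)) : Prop :=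
  ∀ (l m : ℤ) (γ : Γ) (z : N),
    (∑ᶠ i : ℕ, ((-1 : ℤ) ^ i * Ring.choose l i) • aP (m + l - i) (u (γ + i) z))
      - (l.negOnePow : ℤ) •
        (∑ᶠ i : ℕ, ((-1 : ℤ) ^ i * Ring.choose l i) • u (γ + l - i) (aN (m + i) z))
    = ∑ᶠ i : ℕ, Ring.choose m i • au (l + i) (m + γ - i) z

/-- A vertex operator algebra `(V, Y, 𝟙, ω)` over `ℂ`.  A `VertexOperator ℂ V` is a linear map
from `V` to `V((x))`; `(Y a).ncoeff n = a_n` is the coefficient of `x^{-n-1}` in `Y(a, x)`. -/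
class VertexOperatorAlgebra (V : Type u) [AddCommGroup V] [Module ℂ V] where
  /-- the vertex operators -/
  Y : V →ₗ[ℂ] VertexOperator ℂ V
  /-- the vacuum -/
  vac : V
  /-- the conformal vector -/
  ω : V
  /-- the homogeneous subspaces `V_(n)` -/
  grading : ℤ → Submodule ℂ V
  /-- the central charge -/
  rank : ℂ
  isInternal_grading : DirectSum.IsInternal grading
  finiteDimensional_grading : ∀ n, FiniteDimensional ℂ (grading n)
  grading_eq_bot : ∃ N : ℤ, ∀ n < N, grading n = ⊥
  vac_modes : ∀ n : ℤ, (Y vac).ncoeff n = if n = -1 then 1 else 0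
  creation_nonneg : ∀ (a : V) (n : ℤ), 0 ≤ n → (Y a).ncoeff n vac = 0
  creation : ∀ a : V, (Y a).ncoeff (-1) vac = a
  jacobi : ∀ a b : V, JacobiIdentity (Γ := ℤ) (Y a).ncoeff (Y a).ncoeff (Y b).ncoeff
    fun k => (Y ((Y a).ncoeff k b)).ncoeff
  /-- the Virasoro relations for `L(n) = ω_{n+1}` -/
  virasoro : ∀ m n : ℤ, ⁅(Y ω).ncoeff (m + 1), (Y ω).ncoeff (n + 1)⁆ =
    ((m : ℂ) - n) • (Y ω).ncoeff (m + n + 1) +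
      (if m + n = 0 then ((m : ℂ) ^ 3 - m) / 12 * rank else 0) • (1 : Module.End ℂ V)
  /-- `Y(L(-1)a, x) = d/dx Y(a, x)` -/
  derivative : ∀ (a : V) (n : ℤ),
    (Y ((Y ω).ncoeff 0 a)).ncoeff n = (-(n : ℂ)) • (Y a).ncoeff (n - 1)
  /-- `L(0) a = n a` on `V_(n)` -/
  weight : ∀ (n : ℤ), ∀ a ∈ grading n, (Y ω).ncoeff 1 a = (n : ℂ) • a

namespace VertexOperatorAlgebra

variable (V : Type u) [AddCommGroup V] [Module ℂ V] [VertexOperatorAlgebra V]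

variable {V} in
/-- The mode `a_n` on `V`. -/
def mode (a : V) (n : ℤ) : Module.End ℂ V := (Y a).ncoeff n

/-- A homogeneous subspace is the whole eigenspace of `L(0)`. -/
theorem mem_grading_of_weight {n : ℤ} {a : V} (ha : mode (ω : V) 1 a = (n : ℂ) • a) :
    a ∈ grading (V := V) n := by
  have hle : ∀ k, grading (V := V) k ≤ (mode (ω : V) 1).eigenspace (k : ℂ) := fun k b hb =>
    Module.End.mem_eigenspace_iff.2 (weight k b hb)
  have hind : iSupIndep fun k : ℤ => (mode (ω : V) 1).eigenspace (k : ℂ) :=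
    (Module.End.eigenspaces_iSupIndep (mode (ω : V) 1)).comp Int.cast_injective
  have htop := (isInternal_grading (V := V)).submodule_iSup_eq_top
  have hmem : a ∈ grading (V := V) n ⊔ ⨆ (j) (_ : j ≠ n), grading (V := V) j := by
    have : (⨆ j, grading (V := V) j) ≤
        grading (V := V) n ⊔ ⨆ (j) (_ : j ≠ n), grading (V := V) j := by
      refine iSup_le fun j => ?_
      by_cases hj : j = n
      · subst hj; exact le_sup_left
      · exact le_sup_of_le_right (le_iSup₂_of_le j hj le_rfl)
    exact this (htop ▸ Submodule.mem_top)
  obtain ⟨y, hy, z, hz, rfl⟩ := Submodule.mem_sup.1 hmem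
  have hz1 : z ∈ (mode (ω : V) 1).eigenspace (n : ℂ) := by
    have := Submodule.sub_mem _ (Module.End.mem_eigenspace_iff.2 ha) (hle n hy)
    simpa using this
  have hz2 : z ∈ ⨆ (j) (_ : j ≠ n), (mode (ω : V) 1).eigenspace ((j : ℤ) : ℂ) :=
    (iSup₂_mono fun j _ => hle j) hz
  have hz0 : z = 0 := (Submodule.disjoint_def.1 (hind n)) z hz1 hz2
  simpa [hz0] using hy

/-- The conformal vector has weight two. -/
theorem ω_mem_grading : (ω : V) ∈ grading (V := V) 2 := by
  apply mem_grading_of_weight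
  have h := LinearMap.congr_fun (virasoro (V := V) 0 (-2)) vac
  have h1 : (Y (ω : V)).ncoeff 1 vac = 0 := creation_nonneg _ 1 (by norm_num)
  have h2 : (Y (ω : V)).ncoeff (-1) vac = ω := creation _
  norm_num [Ring.lie_def, h1, h2] at h
  simpa [mode] using h

/-! ### The Lie algebra `g(V)` -/

/-- The defining relations of `g(V)` among the generators `a(n) = tⁿ ⊗ a`: linearity in `a`, the
`L(-1)`-relation `(L(-1)a)(n) = -n a(n-1)`, and Borcherds' commutator formula
`[a(m), b(n)] = ∑_{i ≥ 0} (m choose i) (a_i b)(m+n-i)`; this sum is cut at any `N` beyond which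
all the `a_i b` vanish. -/
inductive GRel : FreeLieAlgebra ℂ (ℤ × V) → Prop
  | add (n : ℤ) (a b : V) : GRel
      (FreeLieAlgebra.of ℂ (n, a + b) - FreeLieAlgebra.of ℂ (n, a) - FreeLieAlgebra.of ℂ (n, b))
  | smul (n : ℤ) (c : ℂ) (a : V) : GRel
      (FreeLieAlgebra.of ℂ (n, c • a) - c • FreeLieAlgebra.of ℂ (n, a))
  | derivative (n : ℤ) (a : V) : GRel
      (FreeLieAlgebra.of ℂ (n, mode ω 0 a) + (n : ℂ) • FreeLieAlgebra.of ℂ (n - 1, a))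
  | commutator (m n : ℤ) (a b : V) (N : ℕ) (hN : ∀ i : ℕ, N ≤ i → mode a i b = 0) : GRel
      (⁅FreeLieAlgebra.of ℂ (m, a), FreeLieAlgebra.of ℂ (n, b)⁆ -
        ∑ i ∈ Finset.range N, Ring.choose m i • FreeLieAlgebra.of ℂ (m + n - i, mode a i b))

/-- The Lie algebra `g(V)`, by generators and relations. -/
abbrev G : Type u :=
  FreeLieAlgebra ℂ (ℤ × V) ⧸
    LieSubmodule.lieSpan ℂ (FreeLieAlgebra ℂ (ℤ × V)) {x | GRel V x}

variable {V} in
/-- The element `a(n) = tⁿ ⊗ a` of `g(V)`. -/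
def G.gen (n : ℤ) (a : V) : G V := LieSubmodule.Quotient.mk (FreeLieAlgebra.of ℂ (n, a))

/-- The degree-zero subalgebra `g(V)_0`, where `a(n)` has degree `wt a - n - 1`: it is generated
by the `a(wt a - 1)`.  (Their linear span is closed under the bracket, by the commutator formula,
so that it is all of `g(V)_0`.) -/
def GZero : LieSubalgebra ℂ (G V) :=
  LieSubalgebra.lieSpan ℂ (G V) {x | ∃ (n : ℤ) (a : V), a ∈ grading n ∧ x = G.gen (n - 1) a}

variable {V} in
/-- The element `a(wt a - 1)` of `g(V)_0` for `a ∈ V_(n)`. -/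
def GZero.gen (n : ℤ) (a : V) (ha : a ∈ grading n) : GZero V :=
  ⟨G.gen (n - 1) a, LieSubalgebra.subset_lieSpan ⟨n, a, ha, rfl⟩⟩

/-- The element `L(0) = ω(1)` of `g(V)_0`. -/
def GZero.L0 : GZero V := GZero.gen 2 ω (ω_mem_grading V)

/-! ### Weak modules and modules -/

/-- A weak `V`-module `(M, Y_M)`. -/
class WeakModule (M : Type v) [AddCommGroup M] [Module ℂ M] where
  /-- the vertex operators on `M` -/
  YM : V →ₗ[ℂ] VertexOperator ℂ M
  vac_modes : ∀ n : ℤ, (YM vac).ncoeff n = if n = -1 then 1 else 0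
  derivative : ∀ (a : V) (n : ℤ),
    (YM (mode ω 0 a)).ncoeff n = (-(n : ℂ)) • (YM a).ncoeff (n - 1)
  jacobi : ∀ a b : V, JacobiIdentity (Γ := ℤ) (YM a).ncoeff (YM a).ncoeff (YM b).ncoeff
    fun k => (YM (mode a k b)).ncoeff

section

variable {V} (M : Type v) [AddCommGroup M] [Module ℂ M] [WeakModule V M]

/-- The mode `a_n` on the weak module `M`. -/
def act (a : V) (n : ℤ) : Module.End ℂ M := (WeakModule.YM a).ncoeff n

variable (V)

/-- `L(n) = ω_{n+1}` on the weak module `M`. -/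
def Lop (n : ℤ) : Module.End ℂ M := act M (ω : V) (n + 1)

/-- A weak module `M` is a `V`-module if `M = ⨁_{h ∈ ℂ} M_(h)` where `L(0) = h` on the
finite-dimensional space `M_(h)` and `M_(h+n) = 0` for `n ∈ ℤ` sufficiently small. -/
def IsVModule : Prop :=
  ∃ gr : ℂ → Submodule ℂ M,
    DirectSum.IsInternal gr ∧
    (∀ h, ∀ z ∈ gr h, Lop V M 0 z = h • z) ∧
    (∀ h, FiniteDimensional ℂ (gr h)) ∧
    ∀ h : ℂ, ∃ N : ℤ, ∀ n < N, gr (h + n) = ⊥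

variable {M}

/-- `S` is a weak `V`-submodule. -/
def IsWeakSubmodule (S : Submodule ℂ M) : Prop :=
  ∀ (a : V) (n : ℤ), ∀ z ∈ S, act M a n z ∈ S

/-- The weak `V`-submodule `S` is irreducible as a weak `V`-module (`S = ⊤`: the weak module `M`
itself is irreducible). -/
def IsIrreducibleSub (S : Submodule ℂ M) : Prop :=
  IsWeakSubmodule V S ∧ S ≠ ⊥ ∧
    ∀ T : Submodule ℂ M, IsWeakSubmodule V T → T ≤ S → T = ⊥ ∨ T = S

/-- The subspace `S` has an `ℕ`-gradation `S = ⨁ S(k)` with `a_n S(k) ⊆ S(wt a - n - 1 + k)`, where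
`S(k) = 0` for `k < 0`.  Then `S` is an `ℕ`-gradable weak module (`S = ⊤`: `M` itself is one). -/
def IsNGradableSub (S : Submodule ℂ M) : Prop :=
  ∃ gr : ℤ → Submodule ℂ M,
    iSupIndep gr ∧ (⨆ k, gr k) = S ∧ (∀ k < 0, gr k = ⊥) ∧
    ∀ (m n k : ℤ) (a : V), a ∈ grading m → ∀ z ∈ gr k, act M a n z ∈ gr (m - n - 1 + k)

end

/-- `V` is rational: every `ℕ`-gradable weak `V`-module is the (internal) direct sum of
irreducible `ℕ`-gradable weak `V`-modules. -/
def IsRational : Prop :=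
  ∀ (M : Type u) [AddCommGroup M] [Module ℂ M] [WeakModule V M],
    IsNGradableSub V (⊤ : Submodule ℂ M) →
    ∃ 𝒮 : Set (Submodule ℂ M),
      (∀ S ∈ 𝒮, IsIrreducibleSub V S ∧ IsNGradableSub V S) ∧ sSupIndep 𝒮 ∧ sSup 𝒮 = ⊤

/-- `W` is a lowest weight weak `V`-module of lowest weight `h` with lowest weight subspace `T`:
`T` is annihilated by `g(V)_-`, it generates `W`, and `W = ⨁_{n ∈ ℕ} W_(h+n)` (`L(0)`-eigenspaces,
whose sum is automatically direct) with `W_(h) = T`. -/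
structure IsLowestWeight (W : Type v) [AddCommGroup W] [Module ℂ W] [WeakModule V W]
    (T : Submodule ℂ W) (h : ℂ) : Prop where
  annihilated : ∀ (m n : ℤ) (a : V), a ∈ grading m → m - n - 1 < 0 → ∀ z ∈ T, act W a n z = 0
  generates : ∀ S : Submodule ℂ W, IsWeakSubmodule V S → T ≤ S → S = ⊤
  iSup_eigenspace : (⨆ n : ℕ, (Lop V W 0).eigenspace (h + n)) = ⊤
  eigenspace_eq : (Lop V W 0).eigenspace h = T

/-! ### Series with complex powers and intertwining operators -/

/-- The space `Hom(N, P){x}`; `Φ α` is the coefficient `Φ_α` of `x^{-α-1}`. -/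
abbrev HomSeries (N : Type v) (P : Type w) [AddCommGroup N] [Module ℂ N]
    [AddCommGroup P] [Module ℂ P] : Type (max v w) :=
  ℂ → (N →ₗ[ℂ] P)

section

variable {N : Type v} {P : Type w} [AddCommGroup N] [Module ℂ N] [AddCommGroup P] [Module ℂ P]

/-- The truncation condition: for all `α` and `z`, `Φ_{α+n} z = 0` for `n ∈ ℤ` sufficiently
large. -/
def IsTruncated (Φ : HomSeries N P) : Prop :=
  ∀ (α : ℂ) (z : N), ∃ K : ℤ, ∀ n : ℤ, K ≤ n → Φ (α + n) z = 0

/-- The derivative: `d/dx ∑ Φ_α x^{-α-1} = ∑ (-α) Φ_{α-1} x^{-α-1}`. -/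
def seriesDeriv (Φ : HomSeries N P) : HomSeries N P := fun α => (-α) • Φ (α - 1)

variable [WeakModule V N] [WeakModule V P]

/-- The `L(-1)`-bracket formula `[L(-1), Φ(x)] = d/dx Φ(x)`. -/
def LBracketFormula (Φ : HomSeries N P) : Prop :=
  ∀ α : ℂ, Lop V P (-1) ∘ₗ Φ α - Φ α ∘ₗ Lop V N (-1) = seriesDeriv Φ α

/-- The relation, for all homogeneous `a`, with `d = wt a - 1`,
`(x₁-x₂)^d Y_P(a,x₁)I₀(u,x₂) - (-x₂+x₁)^d I₀(u,x₂)Y_N(a,x₁) = x₁⁻¹δ(x₂/x₁) I₀(a_d u,x₂)`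
applied to any `z`: the coefficients of `x₁^{-p-1} x₂^{-α-1}`. -/
def WeightRelation {U : Type*} [AddCommGroup U] [Module ℂ U] [LieRingModule (GZero V) U]
    (I₀ : U →ₗ[ℂ] HomSeries N P) : Prop :=
  ∀ (n : ℤ) (a : V) (ha : a ∈ grading n) (u : U) (p : ℤ) (α : ℂ) (z : N),
    (∑ᶠ i : ℕ, ((-1 : ℤ) ^ i * Ring.choose (n - 1) i) •
        act P a (p + (n - 1) - i) (I₀ u (α + i) z))
      - ((n - 1).negOnePow : ℤ) •
        (∑ᶠ i : ℕ, ((-1 : ℤ) ^ i * Ring.choose (n - 1) i) •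
          I₀ u (α + ((n - 1 : ℤ) : ℂ) - i) (act N a (p + i) z))
    = I₀ ⁅GZero.gen n a ha, u⁆ (α + p) z

/-- `I` is an intertwining operator of type `(P over W N)`. -/
structure IsIntertwiningOperator {W : Type*} [AddCommGroup W] [Module ℂ W] [WeakModule V W]
    (I : W →ₗ[ℂ] HomSeries N P) : Prop where
  truncation : ∀ u : W, IsTruncated (I u)
  derivative : ∀ u : W, I (Lop V W (-1) u) = seriesDeriv (I u)
  jacobi : ∀ (a : V) (u : W),
    JacobiIdentity (Γ := ℂ) (act P a) (act N a) (I u) fun k => I (act W a k u)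

end

end VertexOperatorAlgebra

end

/-!
The module `W` is found inside a space of series. For weak modules `N`, `P`, a truncated series
`Φ(x)` in `Hom(N, P){x}` is a *generalized intertwining operator* if it is local with all the vertex
operators, `(x₁ - x)^l Y_P(a, x₁) Φ(x) = (-x + x₁)^l Φ(x) Y_N(a, x₁)` for large `l`, and
`[L(-1), Φ(x)] = Φ'(x)` (`genIntertwining`). An element `a ∈ V` acts on truncated series by
`a_n Φ(x) = Res_{x₁} ((x₁ - x)^n Y_P(a, x₁) Φ(x) - (-x + x₁)^n Φ(x) Y_N(a, x₁))`,
which is `op a n 0 Φ`. The generalized intertwining operators form a weak `V`-module under this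
action.

* Borcherds' commutator formula (`op_commutator`) is formal: left and right multiplications satisfy
  such a formula separately (`left_commutator`, `right_commutator`) and commute with each other.
  Dong's lemma, that `a_n Φ` is again local (`isLocalWith_op`), is a consequence.
* The Jacobi identity (`jacobiDefect_eq_zero`) with `(x₁ - x₂)^l`, `l ≥ 0`, follows from the
  commutator formula. For `l < 0`, descending from `l + 1`, the difference of its two sides depends
  only on the sum of the two indices and vanishes when this sum is large. Apply this difference to
  `z ∈ N`, multiply it by powers of `x₁ + x` and `x₂ + x` which depend on `z`, and apply
  `e^{-x L(-1)}`. These operations lose no information, and by weak associativity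
  (`translate_op_pow`) they carry the action on `Φ` to the action on the coefficients of
  `e^{-x L(-1)} Φ(x) z` in `P`, where the Jacobi identity holds.

A local series `Φ` satisfies the Jacobi identity of an intertwining operator, by the definition of
`a_n Φ` (`jacobiIdentity_of_isLocalWith`), so that evaluation is an intertwining operator on the
weak module of generalized intertwining operators.

The relation satisfied by `I₀` says that every `I₀(u, x)` is local with `a` to the order `wt a` and
that `a_{wt a - 1}` acts on it as on `u` (`WeightRelation.op_eq`, `WeightRelation.op_eq_zero`). Thus
`I₀` embeds `U`, and `W` is the weak module that `I₀(U)` generates. As it is spanned by the vectors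
`a_n u` (`isWeakSubmodule_modeSpan`), its weights lie in `h + ℕ` and its vectors of weight `h` are
those of `U`. An intertwining operator on `W` is determined by its values on the generating subspace
`U`. If `V` is rational, `W` is a sum of irreducible weak modules. One of these meets `U`, for
otherwise they would all lie in the sum of the weight spaces for `h + 1, h + 2, …`; it contains `U`
when `U` is irreducible, and so it is `W` (`IsLowestWeight.isIrreducibleSub_top`).
-/

noncomputable section

/-! ### Binomial coefficients and alternating sums -/

/-- The coefficient `(-1)^i (l choose i)` of `y^i` in `(1 - y)^l`. -/
def altChoose (l : ℤ) (i : ℕ) : ℤ := (-1 : ℤ) ^ i * Ring.choose l i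

@[simp]
theorem altChoose_zero_right (l : ℤ) : altChoose l 0 = 1 := by simp [altChoose]

theorem altChoose_zero_succ (i : ℕ) : altChoose 0 (i + 1) = 0 := by
  simp [altChoose, Ring.choose_zero_succ]

theorem altChoose_succ_succ (l : ℤ) (i : ℕ) :
    altChoose (l + 1) (i + 1) = altChoose l (i + 1) - altChoose l i := by
  simp only [altChoose, Ring.choose_succ_succ, pow_succ]; ring

theorem succ_mul_choose_succ (l : ℤ) (i : ℕ) :
    ((i : ℤ) + 1) * Ring.choose l (i + 1) = l * Ring.choose (l - 1) i := by
  have := Ring.choose_smul_choose l (n := i + 1) (k := 1) (by omega)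
  simpa using this

theorem succ_mul_altChoose_succ (l : ℤ) (i : ℕ) :
    ((i : ℤ) + 1) * altChoose l (i + 1) = -l * altChoose (l - 1) i := by
  have := succ_mul_choose_succ l i
  simp only [altChoose, pow_succ]
  linear_combination (-(-1 : ℤ) ^ i) * this

theorem sub_mul_altChoose (l : ℤ) (i : ℕ) :
    (l - i) * altChoose l i = l * altChoose (l - 1) i := by
  cases i with
  | zero => simp
  | succ i =>
    have h1 := succ_mul_altChoose_succ l i
    have h2 := altChoose_succ_succ (l - 1) i
    rw [sub_add_cancel] at h2
    push_cast
    linear_combination l * h2 - h1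

theorem choose_mul_choose_sub (n : ℤ) (i r : ℕ) :
    Ring.choose n i * Ring.choose (n - i) r = Ring.choose n r * Ring.choose (n - r) i := by
  have h1 := Ring.choose_smul_choose n (n := i + r) (k := i) (by omega)
  have h2 := Ring.choose_smul_choose n (n := i + r) (k := r) (by omega)
  rw [Nat.add_sub_cancel_left] at h1
  rw [Nat.add_sub_cancel, ← Nat.choose_symm_add] at h2
  rw [← h1, ← h2]

theorem choose_mul_natChoose (n : ℤ) (i r : ℕ) :
    Ring.choose n (i + r) * Ring.choose ((i + r : ℕ) : ℤ) r =
      Ring.choose n r * Ring.choose (n - r) i := by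
  have h2 := Ring.choose_smul_choose n (n := i + r) (k := r) (by omega)
  rw [Nat.add_sub_cancel] at h2
  rw [← h2, Ring.choose_natCast]; simp [mul_comm]

open Finset in
/-- The coefficient of `y^d` in `(1 - y)^n (1 - y)^l = (1 - y)^(n + l)`. -/
theorem sum_antidiagonal_altChoose (n l : ℤ) (d : ℕ) :
    ∑ p ∈ antidiagonal d, altChoose n p.1 * altChoose l p.2 = altChoose (n + l) d := by
  rw [altChoose, Ring.add_choose_eq d (Commute.all n l), mul_sum]
  refine sum_congr rfl fun p hp => ?_
  rw [← HasAntidiagonal.mem_antidiagonal.1 hp, altChoose, altChoose, pow_add]; ring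

open Finset in
theorem sum_antidiagonal_altChoose_mul_choose_sub (n l : ℤ) (d r : ℕ) :
    ∑ p ∈ antidiagonal d, altChoose n p.1 * altChoose l p.2 * Ring.choose (n - p.1) r =
      Ring.choose n r * altChoose (n + l - r) d := by
  rw [show n + l - r = (n - r) + l by ring, ← sum_antidiagonal_altChoose, mul_sum]
  refine sum_congr rfl fun p _ => ?_
  have := choose_mul_choose_sub n p.1 r
  simp only [altChoose]
  linear_combination ((-1 : ℤ) ^ p.1 * ((-1) ^ p.2 * Ring.choose l p.2)) * this

open Finset in
theorem sum_antidiagonal_add_left {M : Type*} [AddCommMonoid M] (f : ℕ × ℕ → M) (e r : ℕ)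
    (hf : ∀ p, p.1 < r → f p = 0) :
    ∑ p ∈ antidiagonal (e + r), f p = ∑ p ∈ antidiagonal e, f (p.1 + r, p.2) := by
  symm
  refine sum_of_injOn (fun p : ℕ × ℕ => (p.1 + r, p.2)) ?_ ?_ ?_ ?_
  · intro p _ q _ h
    simp only [Prod.mk.injEq] at h
    ext <;> omega
  · intro p hp
    simp only [mem_coe, HasAntidiagonal.mem_antidiagonal] at hp ⊢
    omega
  · intro p hp hp'
    refine hf p (not_le.1 fun hle => hp' ⟨(p.1 - r, p.2), ?_, ?_⟩)
    · simp only [mem_coe, HasAntidiagonal.mem_antidiagonal] at hp ⊢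
      omega
    · ext <;> simp [hle]
  · intros; rfl

open Finset in
theorem sum_antidiagonal_altChoose_mul_choose (n l : ℤ) (e r : ℕ) :
    ∑ p ∈ antidiagonal (e + r), altChoose n p.1 * altChoose l p.2 * Ring.choose (p.1 : ℤ) r =
      (-1) ^ r * Ring.choose n r * altChoose (n + l - r) e := by
  rw [sum_antidiagonal_add_left]
  · rw [show n + l - r = (n - r) + l by ring, ← sum_antidiagonal_altChoose, mul_sum]
    refine sum_congr rfl fun p _ => ?_
    have := choose_mul_natChoose n p.1 r
    simp only [altChoose, pow_add]
    linear_combination ((-1 : ℤ) ^ p.1 * (-1) ^ r * ((-1) ^ p.2 * Ring.choose l p.2)) * this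
  · intro p hp
    rw [Ring.choose_natCast, Nat.choose_eq_zero_of_lt hp]; simp

open Finset in
theorem sum_antidiagonal_mul_choose_of_lt (f : ℕ × ℕ → ℤ) {d r : ℕ} (h : d < r) :
    ∑ p ∈ antidiagonal d, f p * Ring.choose (p.1 : ℤ) r = 0 := by
  refine sum_eq_zero fun p hp => ?_
  have := HasAntidiagonal.mem_antidiagonal.1 hp
  rw [Ring.choose_natCast, Nat.choose_eq_zero_of_lt (by omega)]; simp

open Finset in
theorem sum_range_sum_range_eq_antidiagonal {M : Type*} [AddCommMonoid M] (F : ℕ → ℕ → M) (K : ℕ)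
    (hF : ∀ i j, K ≤ i + j → F i j = 0) :
    ∑ i ∈ range K, ∑ j ∈ range K, F i j =
      ∑ d ∈ range K, ∑ p ∈ antidiagonal d, F p.1 p.2 := by
  rw [← sum_product', sum_sigma']
  symm
  refine sum_of_injOn (fun x : (_ : ℕ) × (ℕ × ℕ) => x.2) ?_ ?_ ?_ ?_
  · rintro ⟨d, p⟩ h ⟨d', p'⟩ h' (rfl : p = p')
    simp only [coe_sigma, Set.mem_sigma_iff, mem_coe, mem_range,
      HasAntidiagonal.mem_antidiagonal] at h h'
    obtain rfl : d = d' := by omega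
    rfl
  · rintro ⟨d, p⟩ h
    simp only [coe_sigma, Set.mem_sigma_iff, mem_coe, mem_range,
      HasAntidiagonal.mem_antidiagonal] at h
    simp only [mem_coe, mem_product, mem_range]
    omega
  · rintro ⟨i, j⟩ _ h
    refine hF i j (not_lt.1 fun hlt => h ⟨⟨i + j, (i, j)⟩, ?_, rfl⟩)
    simpa using hlt
  · intros; rfl

theorem finsum_eq_sum_range {M : Type*} [AddCommMonoid M] {f : ℕ → M} {K : ℕ}
    (hf : ∀ i, K ≤ i → f i = 0) : ∑ᶠ i, f i = ∑ i ∈ Finset.range K, f i := by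
  refine finsum_eq_finsetSum_of_support_subset f fun i hi => ?_
  simp only [Finset.coe_range, Set.mem_Iio]
  exact not_le.1 fun h => hi (hf i h)

section ResidueSum

variable {X : Type*} [AddCommGroup X] {Γ₁ Γ₂ : Type*} [AddCommGroupWithOne Γ₁]
  [AddCommGroupWithOne Γ₂]

/-- For `A(x₁, x₂) = ∑ A_{m,γ} x₁^{-m-1} x₂^{-γ-1}`, the coefficient of `x₁^{-m-1} x₂^{-γ-1}` in
`(x₁ - x₂)^l A(x₁, x₂)`, expanded in nonnegative powers of `x₂`. -/
def expandMul (A : Γ₁ → Γ₂ → X) (l : ℤ) (m : Γ₁) (γ : Γ₂) : X :=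
  ∑ᶠ i : ℕ, altChoose l i • A (m + l - i) (γ + i)

/-- The series `A` is truncated in its second variable, uniformly in the first. -/
def TruncRight (A : Γ₁ → Γ₂ → X) : Prop :=
  ∀ γ, ∃ K : ℕ, ∀ i : ℕ, K ≤ i → ∀ m, A m (γ + i) = 0

theorem expandMul_eq_sum {A : Γ₁ → Γ₂ → X} {γ : Γ₂} {K : ℕ}
    (h : ∀ i : ℕ, K ≤ i → ∀ m, A m (γ + i) = 0) (l : ℤ) (m : Γ₁) :
    expandMul A l m γ = ∑ i ∈ Finset.range K, altChoose l i • A (m + l - i) (γ + i) :=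
  finsum_eq_sum_range fun i hi => by rw [h i hi, smul_zero]

theorem expandMul_zero (A : Γ₁ → Γ₂ → X) (m : Γ₁) (γ : Γ₂) : expandMul A 0 m γ = A m γ := by
  rw [expandMul, finsum_eq_sum_range (K := 1)]
  · simp
  · intro i hi
    obtain ⟨j, rfl⟩ : ∃ j, i = j + 1 := ⟨i - 1, by omega⟩
    rw [altChoose_zero_succ, zero_smul]

/-- Multiplication by `x₁ - x₂`. -/
theorem expandMul_succ {A : Γ₁ → Γ₂ → X} (hA : TruncRight A) (l : ℤ) (m : Γ₁) (γ : Γ₂) :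
    expandMul A (l + 1) m γ = expandMul A l (m + 1) γ - expandMul A l m (γ + 1) := by
  obtain ⟨K, hK⟩ := hA γ
  have h1 : ∀ i : ℕ, K + 1 ≤ i → ∀ m, A m (γ + i) = 0 := fun i hi => hK i (by omega)
  have h2 : ∀ i : ℕ, K ≤ i → ∀ m, A m (γ + 1 + i) = 0 := fun i hi m => by
    have := hK (i + 1) (by omega) m
    rwa [Nat.cast_succ, add_comm (i : Γ₂) 1, ← add_assoc] at this
  rw [expandMul_eq_sum h1, expandMul_eq_sum h1, expandMul_eq_sum h2, Finset.sum_range_succ',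
    Finset.sum_range_succ' _ K, add_sub_right_comm (∑ k ∈ _, _) (altChoose l 0 • _),
    ← Finset.sum_sub_distrib]
  congr 1
  · refine Finset.sum_congr rfl fun i _ => ?_
    rw [altChoose_succ_succ, sub_smul]
    congr 3
    · push_cast; abel
    · push_cast; abel
    · push_cast; abel
  · simp only [altChoose_zero_right, one_smul, Nat.cast_zero, sub_zero, add_zero]
    congr 1; push_cast; abel

end ResidueSum

section Iterate

variable {X : Type*} [AddCommGroup X] {Γ : Type*} [AddCommGroupWithOne Γ]

/-- A family `f l` with `(x₁ - x₂) f l = f (l + 1)` and `f l = 0` for large `l` vanishes as soon as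
its coefficients of `x₁⁻¹` do: those of `x₁^{-m-1}` follow from `x₁ f l = f (l + 1) + x₂ f l`
upwards in `m`, and downwards in `m` by a descending induction on `l`. -/
theorem eq_zero_of_succ {f : ℤ → ℤ → Γ → X} {L : ℤ}
    (hf : ∀ l m γ, f (l + 1) m γ = f l (m + 1) γ - f l m (γ + 1))
    (hL : ∀ l, L ≤ l → ∀ m γ, f l m γ = 0) (h0 : ∀ l γ, f l 0 γ = 0) (l m : ℤ) (γ : Γ) :
    f l m γ = 0 := by
  have hdesc : ∀ m, (∀ l γ, f l (m + 1) γ = 0) → ∀ l γ, f l m γ = 0 := by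
    intro m hm
    have : ∀ (k : ℕ) (l : ℤ), L ≤ l + k → ∀ γ, f l m γ = 0 := by
      intro k
      induction k with
      | zero => intro l hl γ; exact hL l (by simpa using hl) m γ
      | succ k ih =>
        intro l hl γ
        have h1 := hf l m (γ - 1)
        rw [ih (l + 1) (by push_cast at hl; omega), hm, sub_add_cancel, zero_sub] at h1
        exact neg_eq_zero.1 h1.symm
    intro l γ
    exact this (L - l).toNat l (by omega) γ
  induction m using Int.induction_on generalizing l γ with
  | zero => exact h0 l γ
  | succ m ih =>
    have h1 := hf l m γ
    rw [ih, ih, sub_zero] at h1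
    exact h1.symm
  | pred m ih =>
    exact hdesc (-m - 1) (by simpa using ih) l γ

/-- The coefficients of `x₁^{-m-1} x₂^{-γ-1}` in
`∑ i, f (l + i) x₂ · (∂/∂x₂)^i / i! (x₁⁻¹ δ(x₂ / x₁))` satisfy the recursion that describes
multiplication by `x₁ - x₂`. -/
theorem finsum_choose_succ {f : ℤ → Γ → X} {L : ℤ} (hL : ∀ l, L ≤ l → ∀ γ, f l γ = 0)
    (l m : ℤ) (γ : Γ) :
    ∑ᶠ i : ℕ, Ring.choose m i • f (l + 1 + i) (m + γ - i) =
      ∑ᶠ i : ℕ, Ring.choose (m + 1) i • f (l + i) ((m + 1 : ℤ) + γ - i) -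
        ∑ᶠ i : ℕ, Ring.choose m i • f (l + i) (m + (γ + 1) - i) := by
  obtain ⟨K, hK⟩ : ∃ K : ℕ, L ≤ l + K := ⟨(L - l).toNat, by omega⟩
  rw [finsum_eq_sum_range (K := K) fun i hi => by rw [hL _ (by omega), smul_zero],
    finsum_eq_sum_range (K := K + 1) fun i hi => by rw [hL _ (by omega), smul_zero],
    finsum_eq_sum_range (K := K + 1) fun i hi => by rw [hL _ (by omega), smul_zero],
    Finset.sum_range_succ', Finset.sum_range_succ' _ K,
    add_sub_add_comm, ← Finset.sum_sub_distrib]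
  have h0 : Ring.choose (m + 1) 0 • f (l + (0 : ℕ)) (((m + 1 : ℤ) : Γ) + γ - (0 : ℕ)) -
      Ring.choose m 0 • f (l + (0 : ℕ)) (((m : ℤ) : Γ) + (γ + 1) - (0 : ℕ)) = 0 := by
    rw [sub_eq_zero]; simp only [Ring.choose_zero_right, one_smul]
    congr 1; push_cast; abel
  rw [h0, add_zero]
  refine Finset.sum_congr rfl fun i _ => ?_
  rw [Ring.choose_succ_succ, add_smul,
    show l + 1 + (i : ℤ) = l + ((i + 1 : ℕ) : ℤ) by push_cast; ring,
    show ((m + 1 : ℤ) : Γ) + γ - ((i + 1 : ℕ) : Γ) = m + γ - i by push_cast; abel,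
    show (m : Γ) + (γ + 1) - ((i + 1 : ℕ) : Γ) = m + γ - i by push_cast; abel]
  abel

/-- A family `f l` of series in two variables with `(x₁ - x₂) f l = f (l + 1)` and `f l = 0` for
large `l` is a combination of derivatives of the delta function. -/
theorem eq_finsum_choose_of_succ {f : ℤ → ℤ → Γ → X} {L : ℤ}
    (hf : ∀ l m γ, f (l + 1) m γ = f l (m + 1) γ - f l m (γ + 1))
    (hL : ∀ l, L ≤ l → ∀ m γ, f l m γ = 0) (l m : ℤ) (γ : Γ) :
    f l m γ = ∑ᶠ i : ℕ, Ring.choose m i • f (l + i) 0 (m + γ - i) := by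
  refine sub_eq_zero.1 (eq_zero_of_succ (f := fun l m γ => f l m γ -
    ∑ᶠ i : ℕ, Ring.choose m i • f (l + i) 0 (m + γ - i)) (L := L)
    (fun l m γ => ?_) (fun l hl m γ => ?_) (fun l γ => ?_) l m γ)
  · rw [hf l m γ, finsum_choose_succ (f := fun l γ => f l 0 γ) fun l hl => hL l hl 0]
    abel
  · rw [hL l hl, finsum_eq_sum_range (K := 0) fun i _ => by rw [hL _ (by omega), smul_zero]]
    simp
  · rw [finsum_eq_sum_range (K := 1) fun i hi => by
      obtain ⟨j, rfl⟩ : ∃ j, i = j + 1 := ⟨i - 1, by omega⟩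
      rw [Ring.choose_zero_succ, zero_smul]]
    simp

end Iterate

section ResidueSum

variable {X Y : Type*} [AddCommGroup X] [AddCommGroup Y] {Γ₁ Γ₂ : Type*} [AddCommGroupWithOne Γ₁]
  [AddCommGroupWithOne Γ₂]

theorem expandMul_add {A B : Γ₁ → Γ₂ → X} (hA : TruncRight A) (hB : TruncRight B) (l : ℤ) (m : Γ₁)
    (γ : Γ₂) : expandMul (fun m γ => A m γ + B m γ) l m γ =
      expandMul A l m γ + expandMul B l m γ := by
  obtain ⟨K, hK⟩ := hA γ
  obtain ⟨K', hK'⟩ := hB γ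
  rw [expandMul_eq_sum (K := K + K') fun i hi => hK i (by omega),
    expandMul_eq_sum (K := K + K') fun i hi => hK' i (by omega),
    expandMul_eq_sum (K := K + K') fun i hi m => by
      rw [hK i (by omega), hK' i (by omega), add_zero], ← Finset.sum_add_distrib]
  simp only [smul_add]

theorem map_expandMul {A : Γ₁ → Γ₂ → X} (hA : TruncRight A) (f : X →+ Y) (l : ℤ) (m : Γ₁)
    (γ : Γ₂) : f (expandMul A l m γ) = expandMul (fun m γ => f (A m γ)) l m γ := by
  obtain ⟨K, hK⟩ := hA γ
  rw [expandMul_eq_sum hK, expandMul_eq_sum fun i hi m => by rw [hK i hi, map_zero], map_sum]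
  simp only [map_zsmul]

theorem expandMul_smul [Module ℂ X] {A : Γ₁ → Γ₂ → X} (hA : TruncRight A) (c : ℂ) (l : ℤ) (m : Γ₁)
    (γ : Γ₂) : expandMul (fun m γ => c • A m γ) l m γ = c • expandMul A l m γ :=
  (map_expandMul hA (DistribSMul.toAddMonoidHom X c) l m γ).symm

/-- The derivative of `(x₁ - x₂)^l` with respect to `x₁`. -/
theorem expandMul_deriv_left [Module ℂ X] {A : ℤ → Γ₂ → X} (hA : TruncRight A) (l : ℤ) (γ : Γ₂) :
    expandMul (fun (p : ℤ) γ => (-(p : ℂ)) • A (p - 1) γ) l 0 γ =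
      (-(l : ℂ)) • expandMul A (l - 1) 0 γ := by
  obtain ⟨K, hK⟩ := hA γ
  rw [expandMul_eq_sum hK, expandMul_eq_sum fun i hi m => by rw [hK i hi, smul_zero],
    Finset.smul_sum]
  refine Finset.sum_congr rfl fun i _ => ?_
  have h := sub_mul_altChoose l i
  rw [← Int.cast_smul_eq_zsmul ℂ, ← Int.cast_smul_eq_zsmul ℂ, smul_smul, smul_smul]
  congr 1
  · have := congrArg (Int.cast : ℤ → ℂ) h
    push_cast at this ⊢
    linear_combination -this
  · congr 1; simp only [Int.cast_id]; ring

/-- The derivative of `(x₁ - x₂)^l` with respect to `x₂`. -/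
theorem expandMul_deriv_right [Module ℂ X] {A : Γ₁ → ℤ → X} (hA : TruncRight A) (l : ℤ)
    (γ : Γ₁) : expandMul (fun γ (p : ℤ) => (-(p : ℂ)) • A γ (p - 1)) l γ 0 =
      (l : ℂ) • expandMul A (l - 1) γ 0 := by
  obtain ⟨K, hK⟩ := hA 0
  rw [expandMul_eq_sum hK, expandMul_eq_sum (K := K + 1) fun i hi m => by
      obtain ⟨j, rfl⟩ : ∃ j, i = j + 1 := ⟨i - 1, by omega⟩
      have := hK j (by omega) m
      simp only [zero_add, Nat.cast_add, Nat.cast_one, add_sub_cancel_right] at this ⊢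
      rw [this, smul_zero],
    Finset.smul_sum, Finset.sum_range_succ']
  have h0 : altChoose l 0 • (-(((0 : ℤ) + ((0 : ℕ) : ℤ) : ℤ) : ℂ)) •
      A (γ + l - (0 : ℕ)) (0 + (0 : ℕ) - 1) = 0 := by simp
  rw [h0, add_zero]
  refine Finset.sum_congr rfl fun i _ => ?_
  have h := succ_mul_altChoose_succ l i
  rw [← Int.cast_smul_eq_zsmul ℂ, ← Int.cast_smul_eq_zsmul ℂ, smul_smul, smul_smul]
  congr 1
  · have := congrArg (Int.cast : ℤ → ℂ) h
    push_cast at this ⊢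
    simp only [zero_add]
    linear_combination -this
  · congr 1
    · push_cast; abel
    · push_cast; ring

theorem expandMul_deriv_param_right [Module ℂ X] {A : Γ₁ → ℂ → X} (hA : TruncRight A) (l : ℤ)
    (p : Γ₁) (γ : ℂ) : (-γ) • expandMul A l p (γ - 1) =
      expandMul (fun p γ => (-γ) • A p (γ - 1)) l p γ - (l : ℂ) • expandMul A (l - 1) p γ := by
  obtain ⟨K, hK⟩ := hA (γ - 1)
  have hK' : ∀ i : ℕ, K ≤ i → ∀ m, A m (γ + i) = 0 := fun i hi m => by
    have := hK (i + 1) (by omega) m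
    push_cast at this
    rwa [show γ - 1 + ((i : ℂ) + 1) = γ + i by ring] at this
  have hK'' : ∀ i : ℕ, K + 1 ≤ i → ∀ m, A m (γ - 1 + i) = 0 := fun i hi => hK i (by omega)
  have h1 : (-γ) • expandMul A l p (γ - 1) - expandMul (fun p γ => (-γ) • A p (γ - 1)) l p γ =
      ∑ i ∈ Finset.range (K + 1), ((i : ℂ) * altChoose l i) • A (p + l - i) (γ - 1 + i) := by
    rw [expandMul_eq_sum hK'', expandMul_eq_sum (K := K + 1) fun i hi m => by
      rw [show γ + (i : ℂ) - 1 = γ - 1 + i by ring, hK'' i hi, smul_zero], Finset.smul_sum,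
      ← Finset.sum_sub_distrib]
    refine Finset.sum_congr rfl fun i _ => ?_
    rw [show γ + (i : ℂ) - 1 = γ - 1 + i by ring, ← Int.cast_smul_eq_zsmul ℂ,
      ← Int.cast_smul_eq_zsmul ℂ, smul_smul, smul_smul, ← sub_smul]
    congr 1; ring
  have h2 : ∑ i ∈ Finset.range (K + 1), ((i : ℂ) * altChoose l i) • A (p + l - i) (γ - 1 + i) =
      -((l : ℂ) • expandMul A (l - 1) p γ) := by
    rw [expandMul_eq_sum hK', Finset.sum_range_succ', Finset.smul_sum, ← Finset.sum_neg_distrib]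
    simp only [Nat.cast_zero, zero_mul, zero_smul, add_zero]
    refine Finset.sum_congr rfl fun i _ => ?_
    have h := congrArg (Int.cast : ℤ → ℂ) (succ_mul_altChoose_succ l i)
    rw [← Int.cast_smul_eq_zsmul ℂ, smul_smul, ← neg_smul]
    push_cast at h ⊢
    congr 1
    · linear_combination h
    · congr 1
      · abel
      · ring
  rw [h2] at h1
  rw [← sub_eq_zero, sub_sub_eq_add_sub]
  rw [sub_eq_iff_eq_add] at h1
  rw [h1]; abel

theorem expandMul_deriv_param_left [Module ℂ X] {A : ℂ → Γ₂ → X} (hA : TruncRight A) (l : ℤ)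
    (p : Γ₂) (γ : ℂ) : (-γ) • expandMul A l (γ - 1) p =
      expandMul (fun γ p => (-γ) • A (γ - 1) p) l γ p + (l : ℂ) • expandMul A (l - 1) γ p := by
  obtain ⟨K, hK⟩ := hA p
  rw [expandMul_eq_sum hK, expandMul_eq_sum hK, expandMul_eq_sum fun i hi m => by
    rw [hK i hi, smul_zero], Finset.smul_sum, Finset.smul_sum, ← Finset.sum_add_distrib]
  refine Finset.sum_congr rfl fun i _ => ?_
  have h := congrArg (Int.cast : ℤ → ℂ) (sub_mul_altChoose l i)
  push_cast at h ⊢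
  rw [show γ - 1 + (l : ℂ) - i = γ + l - i - 1 by ring,
    show γ + ((l : ℂ) - 1) - i = γ + l - i - 1 by ring, ← Int.cast_smul_eq_zsmul ℂ,
    ← Int.cast_smul_eq_zsmul ℂ, ← Int.cast_smul_eq_zsmul ℂ, smul_smul, smul_smul, smul_smul,
    ← add_smul]
  congr 1
  linear_combination h

end ResidueSum

namespace VertexOperatorAlgebra

section

variable {V : Type u} [AddCommGroup V] [Module ℂ V] [VertexOperatorAlgebra V]
  (M : Type v) [AddCommGroup M] [Module ℂ M] [WeakModule V M]

theorem exists_act_eq_zero (a : V) (z : M) : ∃ K : ℤ, ∀ n, K ≤ n → act M a n z = 0 :=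
  ⟨-((HahnModule.of ℂ).symm (WeakModule.YM a z)).order, fun n hn =>
    VertexOperator.ncoeff_eq_zero_of_lt_order _ n z (by omega)⟩

theorem exists_mode_eq_zero (a b : V) : ∃ K : ℤ, ∀ n, K ≤ n → mode a n b = 0 :=
  ⟨-((HahnModule.of ℂ).symm (Y a b)).order, fun n hn =>
    VertexOperator.ncoeff_eq_zero_of_lt_order _ n b (by omega)⟩

theorem exists_nat_act_eq_zero (a : V) (p : ℤ) (z : M) :
    ∃ K : ℕ, ∀ i : ℕ, K ≤ i → act M a (p + i) z = 0 := by
  obtain ⟨K, hK⟩ := exists_act_eq_zero M a z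
  exact ⟨(K - p).toNat, fun i hi => hK _ (by omega)⟩

@[simp]
theorem act_add (a b : V) (n : ℤ) : act M (a + b) n = act M a n + act M b n := by simp [act]

@[simp]
theorem act_smul (c : ℂ) (a : V) (n : ℤ) : act M (c • a) n = c • act M a n := by simp [act]

@[simp]
theorem act_zero (n : ℤ) : act M (0 : V) n = 0 := by simp [act]

theorem act_vac (n : ℤ) : act M (vac : V) n = if n = -1 then 1 else 0 := WeakModule.vac_modes n

theorem act_derivative (a : V) (n : ℤ) :
    act M (mode ω 0 a) n = (-(n : ℂ)) • act M a (n - 1) := WeakModule.derivative a n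

variable {M} in
/-- Borcherds' commutator formula on a weak module. -/
theorem act_commutator (a b : V) (p q : ℤ) (z : M) {K : ℕ}
    (hK : ∀ i : ℕ, K ≤ i → mode a i b = 0) :
    act M a p (act M b q z) - act M b q (act M a p z) =
      ∑ i ∈ Finset.range K, Ring.choose p i • act M (mode a i b) (p + q - i) z := by
  have h : expandMul (fun p q => act M a p (act M b q z)) 0 p q -
      ((Int.negOnePow 0 : ℤˣ) : ℤ) • expandMul (fun q p => act M b q (act M a p z)) 0 q p =
      ∑ᶠ i : ℕ, Ring.choose p i • act M (mode a (0 + i) b) (p + q - i) z :=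
    WeakModule.jacobi (M := M) a b 0 p q z
  rw [finsum_eq_sum_range (K := K) fun i hi => by simp [hK i hi], expandMul_zero,
    expandMul_zero] at h
  simpa using h

end

/-! ### Truncated series of operators -/

variable {V : Type u} [AddCommGroup V] [Module ℂ V] [VertexOperatorAlgebra V]
variable {N : Type v} {P : Type w} [AddCommGroup N] [Module ℂ N] [AddCommGroup P] [Module ℂ P]

theorem IsTruncated.exists_nat {Φ : HomSeries N P} (h : IsTruncated Φ) (γ : ℂ) (z : N) :
    ∃ K : ℕ, ∀ i : ℕ, K ≤ i → Φ (γ + i) z = 0 := by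
  obtain ⟨K, hK⟩ := h γ z
  exact ⟨K.toNat, fun i hi => by simpa using hK i (by omega)⟩

variable (N P) in
/-- The space of truncated series in `Hom(N, P){x}`. -/
def TruncSeries : Submodule ℂ (HomSeries N P) where
  carrier := {Φ | IsTruncated Φ}
  add_mem' := fun {Φ Ψ} hΦ hΨ α z => by
    obtain ⟨K, hK⟩ := hΦ α z
    obtain ⟨K', hK'⟩ := hΨ α z
    exact ⟨max K K', fun n hn => by
      simp [hK n (le_trans (le_max_left _ _) hn), hK' n (le_trans (le_max_right _ _) hn)]⟩
  zero_mem' := fun α z => ⟨0, fun n _ => by simp⟩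
  smul_mem' := fun c Φ hΦ α z => by
    obtain ⟨K, hK⟩ := hΦ α z
    exact ⟨K, fun n hn => by simp [hK n hn]⟩

namespace TruncSeries

/-- Multiplication of a series by `x`. -/
def shift : TruncSeries N P →ₗ[ℂ] TruncSeries N P where
  toFun Φ := ⟨fun γ => Φ.1 (γ + 1), fun α z => by
    obtain ⟨K, hK⟩ := Φ.2 (α + 1) z
    exact ⟨K, fun n hn => by rw [← hK n hn, add_right_comm]⟩⟩
  map_add' _ _ := rfl
  map_smul' _ _ := rfl

@[simp]
theorem shift_apply (Φ : TruncSeries N P) (γ : ℂ) : (shift Φ).1 γ = Φ.1 (γ + 1) := rfl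

/-- The formal derivative. -/
def deriv : TruncSeries N P →ₗ[ℂ] TruncSeries N P where
  toFun Φ := ⟨seriesDeriv Φ.1, fun α z => by
    obtain ⟨K, hK⟩ := Φ.2 (α - 1) z
    exact ⟨K, fun n hn => by
      simp only [seriesDeriv, LinearMap.smul_apply]
      rw [show α + (n : ℂ) - 1 = α - 1 + n by ring, hK n hn, smul_zero]⟩⟩
  map_add' Φ Ψ := by ext; simp [seriesDeriv]
  map_smul' c Φ := by ext; simp [seriesDeriv, smul_smul, mul_comm]

@[simp]
theorem deriv_apply (Φ : TruncSeries N P) (γ : ℂ) : (deriv Φ).1 γ = (-γ) • Φ.1 (γ - 1) := rfl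

theorem ext_apply {Φ Ψ : TruncSeries N P} (h : ∀ γ z, Φ.1 γ z = Ψ.1 γ z) : Φ = Ψ :=
  Subtype.ext (funext fun γ => LinearMap.ext (h γ))

section Left

variable [WeakModule V P]

theorem truncRight_left (a : V) (Φ : TruncSeries N P) (z : N) :
    TruncRight fun (p : ℤ) γ => act P a p (Φ.1 γ z) := fun γ => by
  obtain ⟨K, hK⟩ := Φ.2.exists_nat γ z
  exact ⟨K, fun i hi m => by simp [hK i hi]⟩

/-- The coefficient of `x₁^{-m-1}` in `(x₁ - x)^l Y_P(a, x₁) Φ(x)`. -/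
def left (a : V) (l m : ℤ) : TruncSeries N P →ₗ[ℂ] TruncSeries N P where
  toFun Φ := ⟨fun γ =>
    { toFun := fun z => expandMul (fun p γ => act P a p (Φ.1 γ z)) l m γ
      map_add' := fun z z' => by
        rw [← expandMul_add (truncRight_left a Φ z) (truncRight_left a Φ z')]
        simp only [map_add]
      map_smul' := fun c z => by
        rw [RingHom.id_apply, ← expandMul_smul (truncRight_left a Φ z)]
        simp only [map_smul] },
    fun α z => by
      obtain ⟨K, hK⟩ := Φ.2 α z
      refine ⟨K, fun n hn => ?_⟩
      have : ∀ i : ℕ, 0 ≤ i → ∀ p, act P a p (Φ.1 (α + n + i) z) = 0 := fun i _ p => by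
        have := hK (n + i) (by omega)
        push_cast at this
        rw [add_assoc, this, map_zero]
      simp only [LinearMap.coe_mk, AddHom.coe_mk]
      rw [expandMul_eq_sum this]; simp⟩
  map_add' Φ Ψ := ext_apply fun γ z => by
    refine Eq.trans ?_ (expandMul_add (truncRight_left a Φ z) (truncRight_left a Ψ z) l m γ)
    simp
  map_smul' c Φ := ext_apply fun γ z => by
    refine Eq.trans ?_ (expandMul_smul (truncRight_left a Φ z) c l m γ)
    simp

theorem left_apply (a : V) (l m : ℤ) (Φ : TruncSeries N P) (γ : ℂ) (z : N) :
    (left a l m Φ).1 γ z = expandMul (fun p γ => act P a p (Φ.1 γ z)) l m γ := rfl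

theorem left_add (a b : V) (l m : ℤ) :
    left (N := N) (P := P) (a + b) l m = left a l m + left b l m :=
  LinearMap.ext fun Φ => ext_apply fun γ z =>
    (by simp [left_apply] : _ = expandMul (fun p γ => act P a p (Φ.1 γ z) + act P b p (Φ.1 γ z))
      l m γ).trans (expandMul_add (truncRight_left a Φ z) (truncRight_left b Φ z) l m γ)

theorem left_smul (c : ℂ) (a : V) (l m : ℤ) :
    left (N := N) (P := P) (c • a) l m = c • left a l m :=
  LinearMap.ext fun Φ => ext_apply fun γ z =>
    (by simp [left_apply] : _ = expandMul (fun p γ => c • act P a p (Φ.1 γ z))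
      l m γ).trans (expandMul_smul (truncRight_left a Φ z) c l m γ)

theorem left_succ (a : V) (l m : ℤ) (Φ : TruncSeries N P) :
    left a (l + 1) m Φ = left a l (m + 1) Φ - shift (left a l m Φ) :=
  ext_apply fun γ z => expandMul_succ (truncRight_left a Φ z) l m γ

theorem left_derivative (a : V) (l : ℤ) (Φ : TruncSeries N P) :
    left (mode ω 0 a) l 0 Φ = (-(l : ℂ)) • left a (l - 1) 0 Φ :=
  ext_apply fun γ z => by
    refine Eq.trans ?_ (expandMul_deriv_left (truncRight_left a Φ z) l γ)
    simp [left_apply, act_derivative]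

theorem deriv_left (a : V) (l : ℤ) (Φ : TruncSeries N P) :
    deriv (left a l 0 Φ) = left a l 0 (deriv Φ) - (l : ℂ) • left a (l - 1) 0 Φ :=
  ext_apply fun γ z => by
    refine (expandMul_deriv_param_right (truncRight_left a Φ z) l 0 γ).trans ?_
    simp [left_apply]

theorem left_vac (l : ℤ) (Φ : TruncSeries N P) :
    left (vac : V) l 0 Φ = if l = -1 then Φ else 0 :=
  ext_apply fun γ z => by
    rw [left_apply, expandMul]
    have key : ∀ i : ℕ, altChoose l i • act P (vac : V) (0 + (Int.cast l : ℤ) - i) (Φ.1 (γ + i) z) =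
        if i = 0 then (if l = -1 then Φ.1 γ z else 0) else 0 := by
      intro i
      rw [act_vac]
      cases i with
      | zero =>
        by_cases hl : l = -1 <;> simp [hl]
      | succ i =>
        simp only [Nat.add_eq_zero_iff, one_ne_zero, and_false, if_false]
        by_cases hi : (0 : ℤ) + (Int.cast l : ℤ) - ((i + 1 : ℕ) : ℤ) = -1
        · obtain rfl : l = (i : ℤ) := by simp only [Int.cast_id] at hi; omega
          rw [altChoose, Ring.choose_natCast, Nat.choose_succ_self]; simp
        · rw [if_neg hi]; simp
    rw [finsum_congr key, finsum_eq_single _ 0 (fun i hi => if_neg hi)]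
    by_cases hl : l = -1 <;> simp [hl]

end Left

section Right

variable [WeakModule V N]

theorem truncRight_right (a : V) (Φ : TruncSeries N P) (z : N) :
    TruncRight fun γ (p : ℤ) => Φ.1 γ (act N a p z) := fun p => by
  obtain ⟨K, hK⟩ := exists_nat_act_eq_zero N a p z
  exact ⟨K, fun i hi γ => by simp [hK i hi]⟩

/-- The coefficient of `x₁^{-m-1}` in `(-x + x₁)^l Φ(x) Y_N(a, x₁)`. -/
def right (a : V) (l m : ℤ) : TruncSeries N P →ₗ[ℂ] TruncSeries N P where
  toFun Φ := ⟨fun γ =>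
    { toFun := fun z => (l.negOnePow : ℤ) • expandMul (fun γ p => Φ.1 γ (act N a p z)) l γ m
      map_add' := fun z z' => by
        rw [← smul_add, ← expandMul_add (truncRight_right a Φ z) (truncRight_right a Φ z')]
        simp only [map_add]
      map_smul' := fun c z => by
        rw [RingHom.id_apply, smul_comm, ← expandMul_smul (truncRight_right a Φ z)]
        simp only [map_smul] },
    fun α z => by
      obtain ⟨K, hK⟩ := exists_nat_act_eq_zero N a m z
      have h1 : ∀ i : ℕ, ∃ K' : ℤ, ∀ n : ℤ, K' ≤ n →
          Φ.1 (α + n + l - i) (act N a (m + i) z) = 0 := fun i => by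
        obtain ⟨K', hK'⟩ := Φ.2 (α + l - i) (act N a (m + i) z)
        exact ⟨K', fun n hn => by
          rw [show α + (n : ℂ) + l - i = α + l - i + n by ring, hK' n hn]⟩
      choose K' hK' using h1
      obtain ⟨B, hB⟩ := ((Finset.range K).image K').bddAbove
      refine ⟨B, fun n hn => ?_⟩
      simp only [LinearMap.coe_mk, AddHom.coe_mk]
      rw [expandMul_eq_sum fun i hi γ => by rw [hK i hi, map_zero], Finset.sum_eq_zero, smul_zero]
      intro i hi
      have hBi : K' i ≤ B := hB (by simpa using ⟨i, by simpa using hi, rfl⟩)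
      have := hK' i n (hBi.trans hn)
      rw [this, smul_zero]⟩
  map_add' Φ Ψ := ext_apply fun γ z => by
    have := expandMul_add (truncRight_right a Φ z) (truncRight_right a Ψ z) l γ m
    exact (congrArg (fun x => (l.negOnePow : ℤ) • x) this).trans (smul_add _ _ _)
  map_smul' c Φ := ext_apply fun γ z => by
    have := expandMul_smul (truncRight_right a Φ z) c l γ m
    exact (congrArg (fun x => (l.negOnePow : ℤ) • x) this).trans (smul_comm _ _ _)

theorem right_apply (a : V) (l m : ℤ) (Φ : TruncSeries N P) (γ : ℂ) (z : N) :
    (right a l m Φ).1 γ z =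
      (l.negOnePow : ℤ) • expandMul (fun γ p => Φ.1 γ (act N a p z)) l γ m := rfl

theorem right_add (a b : V) (l m : ℤ) :
    right (N := N) (P := P) (a + b) l m = right a l m + right b l m :=
  LinearMap.ext fun Φ => ext_apply fun γ z => by
    have := expandMul_add (truncRight_right a Φ z) (truncRight_right b Φ z) l γ m
    refine Eq.trans ?_ ((congrArg (fun x => (l.negOnePow : ℤ) • x) this).trans (smul_add _ _ _))
    simp [right_apply]

theorem right_smul (c : ℂ) (a : V) (l m : ℤ) :
    right (N := N) (P := P) (c • a) l m = c • right a l m :=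
  LinearMap.ext fun Φ => ext_apply fun γ z => by
    have := expandMul_smul (truncRight_right a Φ z) c l γ m
    refine Eq.trans ?_ ((congrArg (fun x => (l.negOnePow : ℤ) • x) this).trans (smul_comm _ _ _))
    simp [right_apply]

theorem right_succ (a : V) (l m : ℤ) (Φ : TruncSeries N P) :
    right a (l + 1) m Φ = right a l (m + 1) Φ - shift (right a l m Φ) :=
  ext_apply fun γ z => by
    have := expandMul_succ (truncRight_right a Φ z) l γ m
    refine (congrArg (fun x => ((l + 1).negOnePow : ℤ) • x) this).trans ?_
    rw [Int.negOnePow_succ, Units.val_neg, neg_smul, smul_sub, neg_sub]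
    rfl

theorem right_derivative (a : V) (l : ℤ) (Φ : TruncSeries N P) :
    right (mode ω 0 a) l 0 Φ = (-(l : ℂ)) • right a (l - 1) 0 Φ :=
  ext_apply fun γ z => by
    have h := expandMul_deriv_right (truncRight_right a Φ z) l γ
    refine Eq.trans ?_ ((congrArg (fun x => (l.negOnePow : ℤ) • x) h).trans ?_)
    · simp [right_apply, act_derivative]
    · simp [right_apply, Int.negOnePow_sub, smul_comm (l : ℂ)]

theorem deriv_right (a : V) (l : ℤ) (Φ : TruncSeries N P) :
    deriv (right a l 0 Φ) = right a l 0 (deriv Φ) - (l : ℂ) • right a (l - 1) 0 Φ :=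
  ext_apply fun γ z => by
    have h := expandMul_deriv_param_left (truncRight_right a Φ z) l 0 γ
    refine Eq.trans ?_ ((congrArg (fun x => (l.negOnePow : ℤ) • x) h).trans ?_)
    · simp [right_apply, smul_comm γ]
    · simp [right_apply, Int.negOnePow_sub, smul_comm (l : ℂ)]

theorem right_vac (l : ℤ) (Φ : TruncSeries N P) : right (vac : V) l 0 Φ = 0 :=
  ext_apply fun γ z => by
    rw [right_apply, expandMul_eq_sum (K := 0)]
    · simp
    · intro i _ γ
      rw [act_vac, if_neg (by omega)]; simp

end Right

end TruncSeries

end VertexOperatorAlgebra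

/-! ### Commutators of left and right multiplications -/

namespace VertexOperatorAlgebra

variable {V : Type u} [AddCommGroup V] [Module ℂ V] [VertexOperatorAlgebra V]
variable {N : Type v} {P : Type w} [AddCommGroup N] [Module ℂ N] [AddCommGroup P] [Module ℂ P]

namespace TruncSeries

open Finset

section Left

variable [WeakModule V P]

theorem left_apply_eq_sum (a : V) (l m : ℤ) (Φ : TruncSeries N P) {γ : ℂ} {z : N} {K : ℕ}
    (hK : ∀ i : ℕ, K ≤ i → Φ.1 (γ + i) z = 0) :
    (left a l m Φ).1 γ z =
      ∑ i ∈ range K, altChoose l i • act P a (m + l - i) (Φ.1 (γ + i) z) := by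
  rw [left_apply, expandMul_eq_sum fun i hi p => by rw [hK i hi, map_zero]]
  simp only [Int.cast_id]

theorem left_left_apply (a b : V) (l m l' m' : ℤ) (Φ : TruncSeries N P) {γ : ℂ} {z : N} {K : ℕ}
    (hK : ∀ i : ℕ, K ≤ i → Φ.1 (γ + i) z = 0) :
    (left a l m (left b l' m' Φ)).1 γ z = ∑ d ∈ range K, ∑ p ∈ antidiagonal d,
      (altChoose l p.1 * altChoose l' p.2) •
        act P a (m + l - p.1) (act P b (m' + l' - p.2) (Φ.1 (γ + d) z)) := by
  have hK' : ∀ i j : ℕ, K ≤ i + j → Φ.1 (γ + i + j) z = 0 := fun i j hij => by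
    rw [add_assoc, ← Nat.cast_add, hK _ hij]
  have h1 : ∀ i : ℕ, (left b l' m' Φ).1 (γ + i) z =
      ∑ j ∈ range K, altChoose l' j • act P b (m' + l' - j) (Φ.1 (γ + i + j) z) := fun i =>
    left_apply_eq_sum b l' m' Φ (K := K) fun j hj => hK' i j (by omega)
  rw [left_apply_eq_sum a l m _ (K := K) fun i hi => by
    rw [h1, sum_eq_zero]; intro j _; rw [hK' i j (by omega), map_zero, smul_zero]]
  simp only [h1, map_sum, map_zsmul, smul_sum, smul_smul]
  rw [sum_range_sum_range_eq_antidiagonal _ K fun i j hij => by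
    rw [hK' i j hij, map_zero, map_zero, smul_zero]]
  refine sum_congr rfl fun d _ => sum_congr rfl fun p hp => ?_
  rw [← HasAntidiagonal.mem_antidiagonal.1 hp, Nat.cast_add, add_assoc]

/-- The commutator formula for left multiplications. -/
theorem left_commutator (a b : V) (n l m : ℤ) (Φ : TruncSeries N P) {M : ℕ}
    (hM : ∀ i : ℕ, M ≤ i → mode a i b = 0) :
    left a n 0 (left b l m Φ) - left b l m (left a n 0 Φ) =
      ∑ r ∈ range M, Ring.choose n r • left (mode a r b) (n + l - r) m Φ :=
  ext_apply fun γ z => by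
    obtain ⟨K, hK⟩ := Φ.2.exists_nat γ z
    have hR : (∑ r ∈ range M, Ring.choose n r • left (mode a r b) (n + l - r) m Φ).1 γ z =
        ∑ r ∈ range M, ∑ d ∈ range K, (Ring.choose n r * altChoose (n + l - r) d) •
          act P (mode a r b) (m + (n + l - r) - d) (Φ.1 (γ + d) z) := by
      simp only [AddSubmonoidClass.coe_finsetSum, Finset.sum_apply, LinearMap.sum_apply]
      refine sum_congr rfl fun r _ => ?_
      refine (congrArg (Ring.choose n r • ·) (left_apply_eq_sum _ _ _ Φ hK)).trans ?_
      simp only [smul_sum, smul_smul]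
    have hL : (left a n 0 (left b l m Φ) - left b l m (left a n 0 Φ)).1 γ z =
        (left a n 0 (left b l m Φ)).1 γ z - (left b l m (left a n 0 Φ)).1 γ z := rfl
    rw [hR, hL, left_left_apply a b n 0 l m Φ hK, left_left_apply b a l m n 0 Φ hK, sum_comm,
      ← sum_sub_distrib]
    refine sum_congr rfl fun d _ => ?_
    rw [← Nat.sum_antidiagonal_swap (n := d) (f := fun p : ℕ × ℕ =>
      (altChoose l p.1 * altChoose n p.2) •
        act P b (m + l - p.1) (act P a (0 + n - p.2) (Φ.1 (γ + d) z))),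
      ← sum_sub_distrib]
    have : ∀ p ∈ antidiagonal d, (altChoose n p.1 * altChoose l p.2) •
        act P a (0 + n - p.1) (act P b (m + l - p.2) (Φ.1 (γ + d) z)) -
        (altChoose l p.swap.1 * altChoose n p.swap.2) •
          act P b (m + l - p.swap.1) (act P a (0 + n - p.swap.2) (Φ.1 (γ + d) z)) =
        ∑ r ∈ range M, (altChoose n p.1 * altChoose l p.2 * Ring.choose (n - p.1) r) •
          act P (mode a r b) (m + (n + l - r) - d) (Φ.1 (γ + d) z) := by
      intro p hp
      simp only [Prod.fst_swap, Prod.snd_swap, zero_add]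
      rw [mul_comm (altChoose l p.2), ← smul_sub, act_commutator a b _ _ _ hM, smul_sum]
      refine sum_congr rfl fun r _ => ?_
      rw [smul_smul, ← HasAntidiagonal.mem_antidiagonal.1 hp]
      congr 3
      push_cast; ring
    rw [sum_congr rfl this, sum_comm]
    refine sum_congr rfl fun r _ => ?_
    rw [← sum_smul, sum_antidiagonal_altChoose_mul_choose_sub]

end Left

section Right

variable [WeakModule V N]

theorem right_apply_eq_sum (a : V) (l m : ℤ) (Φ : TruncSeries N P) (γ : ℂ) {z : N} {K : ℕ}
    (hK : ∀ i : ℕ, K ≤ i → act N a (m + i) z = 0) :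
    (right a l m Φ).1 γ z = (l.negOnePow : ℤ) •
      ∑ i ∈ range K, altChoose l i • Φ.1 (γ + l - i) (act N a (m + i) z) := by
  rw [right_apply, expandMul_eq_sum fun i hi p => by simp [hK i hi]]

theorem right_right_apply (a b : V) (l m l' m' : ℤ) (Φ : TruncSeries N P) (γ : ℂ) {z : N} {K : ℕ}
    (hK : ∀ i : ℕ, K ≤ i → act N a (m + i) z = 0)
    (hK' : ∀ i j : ℕ, K ≤ i + j → act N b (m' + j) (act N a (m + i) z) = 0) :
    (right a l m (right b l' m' Φ)).1 γ z = ((l + l').negOnePow : ℤ) •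
      ∑ d ∈ range K, ∑ p ∈ antidiagonal d, (altChoose l p.1 * altChoose l' p.2) •
        Φ.1 (γ + (l + l' : ℤ) - d) (act N b (m' + p.2) (act N a (m + p.1) z)) := by
  have h1 : ∀ i : ℕ, (right b l' m' Φ).1 (γ + l - i) (act N a (m + i) z) =
      (l'.negOnePow : ℤ) • ∑ j ∈ range K, altChoose l' j •
        Φ.1 (γ + l - i + l' - j) (act N b (m' + j) (act N a (m + i) z)) := fun i =>
    right_apply_eq_sum b l' m' Φ _ fun j hj => hK' i j (by omega)
  rw [right_apply_eq_sum a l m _ γ hK]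
  simp only [h1, smul_sum, smul_smul]
  rw [sum_range_sum_range_eq_antidiagonal _ K fun i j hij => by
    rw [hK' i j hij, map_zero, smul_zero]]
  refine sum_congr rfl fun d _ => sum_congr rfl fun p hp => ?_
  rw [← HasAntidiagonal.mem_antidiagonal.1 hp, Int.negOnePow_add, Units.val_mul]
  rw [show γ + l - p.1 + l' - p.2 = γ + ((l + l' : ℤ) : ℂ) - ((p.1 + p.2 : ℕ) : ℂ) by
    push_cast; ring]
  congr 1; ring

theorem exists_act_act_eq_zero (a b : V) (p q : ℤ) (z : N) :
    ∃ K : ℕ, ∀ i j : ℕ, K ≤ i + j → act N b (q + j) (act N a (p + i) z) = 0 := by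
  obtain ⟨K, hK⟩ := exists_nat_act_eq_zero N a p z
  choose K' hK' using fun i : ℕ => exists_nat_act_eq_zero N b q (act N a (p + i) z)
  obtain ⟨B, hB⟩ := ((Finset.range K).image K').bddAbove
  refine ⟨K + B, fun i j hij => ?_⟩
  by_cases hi : K ≤ i
  · rw [hK i hi, map_zero]
  · have : K' i ≤ B := hB (by simpa using ⟨i, not_le.1 hi, rfl⟩)
    exact hK' i j (by omega)

/-- The commutator formula for right multiplications, which reverse the order of products. -/
theorem right_commutator (a b : V) (n l m : ℤ) (Φ : TruncSeries N P) {M : ℕ}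
    (hM : ∀ i : ℕ, M ≤ i → mode a i b = 0) :
    right a n 0 (right b l m Φ) - right b l m (right a n 0 Φ) =
      -∑ r ∈ range M, Ring.choose n r • right (mode a r b) (n + l - r) m Φ :=
  ext_apply fun γ z => by
    obtain ⟨K₁, hK₁⟩ := exists_nat_act_eq_zero N a 0 z
    obtain ⟨K₂, hK₂⟩ := exists_nat_act_eq_zero N b m z
    obtain ⟨K₃, hK₃⟩ := exists_act_act_eq_zero a b 0 m z
    obtain ⟨K₄, hK₄⟩ := exists_act_act_eq_zero b a m 0 z
    choose K' hK' using fun r : ℕ => exists_nat_act_eq_zero N (mode a r b) m z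
    obtain ⟨B, hB⟩ := ((Finset.range M).image K').bddAbove
    -- Beyond `K + M` all terms vanish; the surplus `M` absorbs the shift of the index by `r < M`.
    obtain ⟨K, hK⟩ : ∃ K, K = K₁ + K₂ + K₃ + K₄ + B := ⟨_, rfl⟩
    have hR : (-∑ r ∈ range M, Ring.choose n r • right (mode a r b) (n + l - r) m Φ).1 γ z =
        -∑ r ∈ range M, ∑ d ∈ range (K + M), ((n + l).negOnePow : ℤ) •
          (∑ p ∈ antidiagonal d,
            altChoose n p.1 * altChoose l p.2 * Ring.choose (p.1 : ℤ) r) •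
          Φ.1 (γ + (n + l : ℤ) - d) (act N (mode a r b) (m + d - r) z) := by
      have e : (-∑ r ∈ range M, Ring.choose n r • right (mode a r b) (n + l - r) m Φ).1 γ z =
          -(∑ r ∈ range M, Ring.choose n r • right (mode a r b) (n + l - r) m Φ).1 γ z := rfl
      rw [e]
      simp only [AddSubmonoidClass.coe_finsetSum, Finset.sum_apply, LinearMap.sum_apply]
      refine congrArg _ (sum_congr rfl fun r hr => ?_)
      have hr' : r < M := by simpa using hr
      have hBr : K' r ≤ B := hB (by simpa using ⟨r, hr', rfl⟩)
      refine (congrArg (Ring.choose n r • ·) (right_apply_eq_sum _ _ _ Φ γ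
        (K := K + M - r) fun i hi => hK' r i (by omega))).trans ?_
      rw [show K + M = r + (K + M - r) by omega, sum_range_add,
        sum_eq_zero (s := range r) fun d hd => by
          rw [sum_antidiagonal_mul_choose_of_lt (fun p => altChoose n p.1 * altChoose l p.2)
            (by simpa using hd), zero_smul, smul_zero], zero_add, Nat.add_sub_cancel_left]
      simp only [smul_sum, smul_smul]
      refine sum_congr rfl fun e _ => ?_
      rw [add_comm r e, sum_antidiagonal_altChoose_mul_choose]
      rw [show γ + ((n + l : ℤ) : ℂ) - ((e + r : ℕ) : ℂ) = γ + ((n + l - r : ℤ) : ℂ) - e by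
        push_cast; ring, show m + ((e + r : ℕ) : ℤ) - r = m + e by push_cast; ring]
      congr 1
      rw [Int.negOnePow_sub, Units.val_mul, Int.negOnePow_def (r : ℤ)]
      simp; ring
    have hL : (right a n 0 (right b l m Φ) - right b l m (right a n 0 Φ)).1 γ z =
        (right a n 0 (right b l m Φ)).1 γ z - (right b l m (right a n 0 Φ)).1 γ z := rfl
    rw [hR, hL, right_right_apply a b n 0 l m Φ γ (K := K + M) (fun i hi => hK₁ i (by omega))
        (fun i j hij => hK₃ i j (by omega)),
      right_right_apply b a l m n 0 Φ γ (K := K + M) (fun i hi => hK₂ i (by omega))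
        (fun i j hij => hK₄ i j (by omega)), sum_comm, add_comm l n, ← smul_sub,
      ← sum_sub_distrib, ← sum_neg_distrib, smul_sum]
    refine sum_congr rfl fun d _ => ?_
    rw [← smul_sum, ← smul_neg]
    congr 1
    rw [← Nat.sum_antidiagonal_swap (n := d) (f := fun p : ℕ × ℕ =>
      (altChoose l p.1 * altChoose n p.2) •
        Φ.1 (γ + (n + l : ℤ) - d) (act N a (0 + p.2) (act N b (m + p.1) z))),
      ← sum_sub_distrib]
    have : ∀ p ∈ antidiagonal d, (altChoose n p.1 * altChoose l p.2) •
        Φ.1 (γ + (n + l : ℤ) - d) (act N b (m + p.2) (act N a (0 + p.1) z)) -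
        (altChoose l p.swap.1 * altChoose n p.swap.2) •
          Φ.1 (γ + (n + l : ℤ) - d) (act N a (0 + p.swap.2) (act N b (m + p.swap.1) z)) =
        -∑ r ∈ range M, (altChoose n p.1 * altChoose l p.2 * Ring.choose (p.1 : ℤ) r) •
          Φ.1 (γ + (n + l : ℤ) - d) (act N (mode a r b) (m + d - r) z) := by
      intro p hp
      simp only [Prod.fst_swap, Prod.snd_swap, zero_add]
      rw [mul_comm (altChoose l p.2), ← smul_sub, ← map_sub,
        ← neg_sub (act N a p.1 _), map_neg,
        act_commutator a b _ _ _ hM, smul_neg, map_sum, smul_sum]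
      refine congrArg _ (sum_congr rfl fun r _ => ?_)
      rw [map_zsmul, smul_smul]
      congr 4
      rw [← HasAntidiagonal.mem_antidiagonal.1 hp]
      push_cast; ring
    rw [sum_congr rfl this, sum_neg_distrib, sum_comm]
    refine congrArg _ (sum_congr rfl fun r _ => ?_)
    rw [← sum_smul]

end Right

section Mixed

variable [WeakModule V N] [WeakModule V P]

theorem left_right_commute (a b : V) (l m l' m' : ℤ) (Φ : TruncSeries N P) :
    left a l m (right b l' m' Φ) = right b l' m' (left a l m Φ) :=
  ext_apply fun γ z => by
    obtain ⟨K, hK⟩ := exists_nat_act_eq_zero N b m' z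
    choose K' hK' using fun j : ℕ => Φ.2.exists_nat (γ + l' - j) (act N b (m' + j) z)
    obtain ⟨B, hB⟩ := ((Finset.range K).image K').bddAbove
    have hB' : ∀ j ∈ range K, ∀ i : ℕ, B ≤ i →
        Φ.1 (γ + l' - j + i) (act N b (m' + j) z) = 0 := fun j hj i hi =>
      hK' j i ((hB (by simpa using ⟨j, by simpa using hj, rfl⟩)).trans hi)
    have e : ∀ i j : ℕ, γ + i + l' - j = γ + l' - j + i := fun i j => by ring
    have h1 : ∀ i : ℕ, (right b l' m' Φ).1 (γ + i) z = (l'.negOnePow : ℤ) •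
        ∑ j ∈ range K, altChoose l' j • Φ.1 (γ + l' - j + i) (act N b (m' + j) z) := fun i => by
      simp only [right_apply_eq_sum b l' m' Φ (γ + i) hK, e]
    have h2 : ∀ j ∈ range K, (left a l m Φ).1 (γ + l' - j) (act N b (m' + j) z) =
        ∑ i ∈ range B, altChoose l i •
          act P a (m + l - i) (Φ.1 (γ + l' - j + i) (act N b (m' + j) z)) := fun j hj =>
      left_apply_eq_sum a l m Φ (hB' j hj)
    rw [left_apply_eq_sum a l m (right b l' m' Φ) (K := B) fun i hi => by
      rw [h1, sum_eq_zero, smul_zero]; intro j hj; rw [hB' j hj i hi, smul_zero],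
      right_apply_eq_sum b l' m' (left a l m Φ) γ hK,
      sum_congr rfl fun j hj => congrArg (altChoose l' j • ·) (h2 j hj)]
    simp only [h1, map_zsmul, map_sum, smul_sum]
    rw [sum_comm]
    refine sum_congr rfl fun j _ => sum_congr rfl fun i _ => ?_
    rw [smul_comm (altChoose l i), smul_comm (altChoose l i)]

end Mixed

end TruncSeries
end VertexOperatorAlgebra

/-! ### The action of `V` on truncated series -/

namespace VertexOperatorAlgebra

variable {V : Type u} [AddCommGroup V] [Module ℂ V] [VertexOperatorAlgebra V]
variable {N : Type v} {P : Type w} [AddCommGroup N] [Module ℂ N] [AddCommGroup P] [Module ℂ P]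

namespace TruncSeries

theorem left_shift [WeakModule V P] (a : V) (l m : ℤ) (Φ : TruncSeries N P) :
    left a l m (shift Φ) = shift (left a l m Φ) :=
  ext_apply fun γ z => by
    simp only [left_apply, shift_apply, expandMul, add_right_comm]

theorem right_shift [WeakModule V N] (a : V) (l m : ℤ) (Φ : TruncSeries N P) :
    right a l m (shift Φ) = shift (right a l m Φ) :=
  ext_apply fun γ z => by
    simp only [right_apply, shift_apply, expandMul]
    congr 2
    funext i
    rw [show γ + l - i + 1 = γ + 1 + l - i by ring]

variable [WeakModule V N] [WeakModule V P]

/-- The coefficient of `x₁^{-m-1}` in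
`(x₁ - x)^l Y_P(a, x₁) Φ(x) - (-x + x₁)^l Φ(x) Y_N(a, x₁)`. The operators `op a n 0` are the modes
of the action of `V` on series. -/
def op (a : V) (l m : ℤ) : TruncSeries N P →ₗ[ℂ] TruncSeries N P := left a l m - right a l m

theorem op_apply (a : V) (l m : ℤ) (Φ : TruncSeries N P) :
    op a l m Φ = left a l m Φ - right a l m Φ := rfl

theorem op_coeff (a : V) (l m : ℤ) (Φ : TruncSeries N P) (γ : ℂ) (z : N) :
    (op a l m Φ).1 γ z = (left a l m Φ).1 γ z - (right a l m Φ).1 γ z := rfl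

theorem op_add (a b : V) (l m : ℤ) :
    op (N := N) (P := P) (a + b) l m = op a l m + op b l m := by
  simp only [op, left_add, right_add]; abel

theorem op_smul (c : ℂ) (a : V) (l m : ℤ) :
    op (N := N) (P := P) (c • a) l m = c • op a l m := by
  rw [op, left_smul, right_smul]
  exact LinearMap.ext fun Φ => (smul_sub c (left a l m Φ) (right a l m Φ)).symm

variable (V N P) in
/-- `op a l m` as a linear function of `a`. -/
def opLinear (l m : ℤ) : V →ₗ[ℂ] Module.End ℂ (TruncSeries N P) where
  toFun a := op a l m
  map_add' a b := op_add a b l m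
  map_smul' c a := op_smul c a l m

theorem op_zero (l m : ℤ) : op (N := N) (P := P) (0 : V) l m = 0 := (opLinear V N P l m).map_zero

theorem op_succ (a : V) (l m : ℤ) (Φ : TruncSeries N P) :
    op a (l + 1) m Φ = op a l (m + 1) Φ - shift (op a l m Φ) := by
  simp only [op_apply, left_succ, right_succ, map_sub]; abel

theorem op_shift (a : V) (l m : ℤ) (Φ : TruncSeries N P) :
    op a l m (shift Φ) = shift (op a l m Φ) := by
  simp only [op_apply, left_shift, right_shift, map_sub]

theorem op_derivative (a : V) (l : ℤ) (Φ : TruncSeries N P) :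
    op (mode ω 0 a) l 0 Φ = (-(l : ℂ)) • op a (l - 1) 0 Φ := by
  simp only [op_apply, left_derivative, right_derivative, smul_sub]

theorem deriv_op (a : V) (l : ℤ) (Φ : TruncSeries N P) :
    deriv (op a l 0 Φ) = op a l 0 (deriv Φ) - (l : ℂ) • op a (l - 1) 0 Φ := by
  simp only [op_apply, map_sub, deriv_left, deriv_right, smul_sub]; abel

theorem op_vac (l : ℤ) (Φ : TruncSeries N P) :
    op (vac : V) l 0 Φ = if l = -1 then Φ else 0 := by
  rw [op_apply, left_vac, right_vac, sub_zero]

open Finset in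
/-- Borcherds' commutator formula for the action on series. It holds without any locality
assumption, because left and right multiplications commute. -/
theorem op_commutator (a b : V) (n l m : ℤ) (Φ : TruncSeries N P) {M : ℕ}
    (hM : ∀ i : ℕ, M ≤ i → mode a i b = 0) :
    op a n 0 (op b l m Φ) - op b l m (op a n 0 Φ) =
      ∑ r ∈ range M, Ring.choose n r • op (mode a r b) (n + l - r) m Φ := by
  have h1 := left_commutator a b n l m Φ hM
  have h2 := right_commutator a b n l m Φ hM
  have h3 := left_right_commute a b n 0 l m Φ
  have h4 := left_right_commute b a l m n 0 Φ
  have h5 : ∑ r ∈ range M, Ring.choose n r • op (mode a r b) (n + l - r) m Φ =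
      ∑ r ∈ range M, Ring.choose n r • left (mode a r b) (n + l - r) m Φ -
      ∑ r ∈ range M, Ring.choose n r • right (mode a r b) (n + l - r) m Φ := by
    rw [← sum_sub_distrib]
    exact sum_congr rfl fun r _ => by rw [op_apply, smul_sub]
  rw [h5, ← h1, ← neg_neg (∑ r ∈ range M, _ • right _ _ m Φ), ← h2]
  simp only [op_apply, map_sub, h3, h4]
  abel

/-- `Φ(x)` and `Y(a, x₁)` are mutually local: `(x₁ - x)^l` kills their commutator for large `l`. -/
def IsLocalWith (a : V) (Φ : TruncSeries N P) : Prop :=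
  ∃ L : ℤ, ∀ l, L ≤ l → ∀ m, op a l m Φ = 0

variable (V N P) in
/-- The space of generalized intertwining operators from `N` to `P`: truncated series which are
local with all vertex operators and on which `L(-1)` acts by the formal derivative. -/
def genIntertwining : Submodule ℂ (TruncSeries N P) where
  carrier := {Φ | (∀ a : V, IsLocalWith a Φ) ∧ op (ω : V) 0 0 Φ = deriv Φ}
  add_mem' := fun {Φ Ψ} hΦ hΨ => ⟨fun a => by
    obtain ⟨L, hL⟩ := hΦ.1 a
    obtain ⟨L', hL'⟩ := hΨ.1 a
    exact ⟨max L L', fun l hl m => by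
      rw [map_add, hL l (le_trans (le_max_left _ _) hl), hL' l (le_trans (le_max_right _ _) hl),
        add_zero]⟩, by rw [map_add, map_add, hΦ.2, hΨ.2]⟩
  zero_mem' := ⟨fun a => ⟨0, fun l _ m => map_zero _⟩, by simp⟩
  smul_mem' := fun c Φ hΦ => ⟨fun a => by
    obtain ⟨L, hL⟩ := hΦ.1 a
    exact ⟨L, fun l hl m => by rw [map_smul, hL l hl, smul_zero]⟩, by
      rw [map_smul, map_smul, hΦ.2]⟩

theorem exists_nat_mode_eq_zero (a b : V) (p : ℤ) :
    ∃ K : ℕ, ∀ i : ℕ, K ≤ i → mode a (p + i) b = 0 := by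
  obtain ⟨K, hK⟩ := exists_mode_eq_zero a b
  exact ⟨(K - p).toNat, fun i hi => hK _ (by omega)⟩

theorem exists_nat_mode_eq_zero' (a b : V) : ∃ K : ℕ, ∀ i : ℕ, K ≤ i → mode a i b = 0 := by
  simpa using exists_nat_mode_eq_zero a b 0

/-- Dong's lemma: locality is inherited by `a_n Φ`, by the commutator formula. -/
theorem isLocalWith_op {Φ : TruncSeries N P} (hΦ : ∀ a : V, IsLocalWith a Φ) (a b : V) (n : ℤ) :
    IsLocalWith b (op a n 0 Φ) := by
  obtain ⟨M, hM⟩ := exists_nat_mode_eq_zero' a b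
  obtain ⟨L, hL⟩ := hΦ b
  choose L' hL' using fun r : ℕ => hΦ (mode a r b)
  obtain ⟨B, hB⟩ := ((Finset.range M).image L').bddAbove
  refine ⟨max L (B - n + M), fun l hl m => ?_⟩
  have h := op_commutator a b n l m Φ hM
  rw [hL l (le_trans (le_max_left _ _) hl), map_zero, zero_sub, Finset.sum_eq_zero] at h
  · exact neg_eq_zero.1 h
  · intro r hr
    have hr' : r < M := by simpa using hr
    have hBr : L' r ≤ B := hB (by simpa using ⟨r, hr', rfl⟩)
    have hl' := le_trans (le_max_right _ _) hl
    rw [hL' r _ (by omega), smul_zero]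

theorem op_mem_genIntertwining {Φ : TruncSeries N P} (hΦ : Φ ∈ genIntertwining V N P) (a : V)
    (n : ℤ) : op a n 0 Φ ∈ genIntertwining V N P := by
  refine ⟨fun b => isLocalWith_op hΦ.1 a b n, ?_⟩
  obtain ⟨M, hM⟩ := exists_nat_mode_eq_zero' (ω : V) a
  have h := op_commutator (ω : V) a 0 n 0 Φ (M := M + 1) fun i hi => hM i (by omega)
  rw [Finset.sum_eq_single_of_mem 0 (by simp)] at h
  · simp only [Ring.choose_zero_right, one_smul, Nat.cast_zero, zero_add, sub_zero,
      op_derivative] at h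
    rw [deriv_op, ← hΦ.2, sub_eq_iff_eq_add.1 h, add_comm,
      sub_eq_add_neg (op a n 0 _)]
    exact congrArg _ (neg_smul (n : ℂ) (op a (n - 1) 0 Φ))
  · intro i _ hi
    obtain ⟨j, rfl⟩ : ∃ j, i = j + 1 := ⟨i - 1, by omega⟩
    rw [Ring.choose_zero_succ, zero_smul]

/-- Locality and the definition of `a_n Φ` give the Jacobi identity for `a` and `Φ`. -/
theorem jacobiIdentity_of_isLocalWith {a : V} {Φ : TruncSeries N P} (hΦ : IsLocalWith a Φ) :
    JacobiIdentity (Γ := ℂ) (act P a) (act N a) Φ.1 fun k => (op a k 0 Φ).1 := by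
  intro l m γ z
  obtain ⟨L, hL⟩ := hΦ
  refine (eq_finsum_choose_of_succ (f := fun l m γ => (op a l m Φ).1 γ z) (L := L) ?_ ?_ l m γ)
  · intro l m γ
    rw [op_succ]; rfl
  · intro l hl m γ
    rw [hL l hl]; rfl

end TruncSeries
end VertexOperatorAlgebra

/-! ### The exponential of `L(-1)` -/

namespace VertexOperatorAlgebra

variable {V : Type u} [AddCommGroup V] [Module ℂ V] [VertexOperatorAlgebra V]
variable {N : Type v} {P : Type w} [AddCommGroup N] [Module ℂ N] [AddCommGroup P] [Module ℂ P]

section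

variable [WeakModule V P]

/-- `[a_p, L(-1)] = p a_{p-1}`. -/
theorem act_omega_zero (a : V) (p : ℤ) (v : P) :
    act P a p (act P (ω : V) 0 v) =
      act P (ω : V) 0 (act P a p v) + (p : ℂ) • act P a (p - 1) v := by
  obtain ⟨M, hM⟩ := TruncSeries.exists_nat_mode_eq_zero' (ω : V) a
  have h := act_commutator (ω : V) a 0 p v (K := M + 1) fun i hi => hM i (by omega)
  rw [Finset.sum_eq_single_of_mem 0 (by simp)] at h
  · simp only [Ring.choose_zero_right, one_smul, Nat.cast_zero, zero_add, sub_zero,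
      act_derivative, LinearMap.smul_apply] at h
    rw [sub_eq_iff_eq_add] at h
    rw [h, neg_smul]; abel
  · intro i _ hi
    obtain ⟨j, rfl⟩ : ∃ j, i = j + 1 := ⟨i - 1, by omega⟩
    rw [Ring.choose_zero_succ, zero_smul]

open Finset in
/-- `a(x₁) e^{x L(-1)} = e^{x L(-1)} a(x₁ - x)`, in components. -/
theorem act_omega_zero_pow (a : V) (p : ℤ) (u : ℕ) (v : P) :
    ((u.factorial : ℂ)⁻¹) • act P a p ((act P (ω : V) 0 ^ u) v) =
      ∑ x ∈ antidiagonal u, (((Ring.choose p x.1 : ℤ) : ℂ) * (x.2.factorial : ℂ)⁻¹) •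
        (act P (ω : V) 0 ^ x.2) (act P a (p - x.1) v) := by
  induction u generalizing v with
  | zero => simp
  | succ u ih =>
    have hu : ((u : ℂ) + 1) ≠ 0 := by exact_mod_cast Nat.succ_ne_zero u
    have h1 : ((u : ℂ) + 1) • ((((u + 1).factorial : ℕ) : ℂ)⁻¹) •
        act P a p ((act P (ω : V) 0 ^ (u + 1)) v) =
        ∑ x ∈ antidiagonal u, (((Ring.choose p x.1 : ℤ) : ℂ) * (x.2.factorial : ℂ)⁻¹) •
          ((act P (ω : V) 0 ^ (x.2 + 1)) (act P a (p - x.1) v) +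
            ((p - x.1 : ℤ) : ℂ) • (act P (ω : V) 0 ^ x.2) (act P a (p - (x.1 + 1 : ℕ)) v)) := by
      rw [pow_succ, Module.End.mul_apply, smul_smul, Nat.factorial_succ]
      rw [show ((u : ℂ) + 1) * (((u + 1) * u.factorial : ℕ) : ℂ)⁻¹ = (u.factorial : ℂ)⁻¹ by
        push_cast; field_simp, ih]
      refine sum_congr rfl fun x _ => ?_
      rw [act_omega_zero, map_add, map_smul, pow_succ, Module.End.mul_apply, sub_sub,
        Nat.cast_succ]
    have h2 : ((u : ℂ) + 1) • ∑ x ∈ antidiagonal (u + 1),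
        (((Ring.choose p x.1 : ℤ) : ℂ) * (x.2.factorial : ℂ)⁻¹) •
          (act P (ω : V) 0 ^ x.2) (act P a (p - x.1) v) =
        ∑ x ∈ antidiagonal (u + 1),
          ((x.2 : ℂ) * ((Ring.choose p x.1 : ℤ) * (x.2.factorial : ℂ)⁻¹)) •
          (act P (ω : V) 0 ^ x.2) (act P a (p - x.1) v) +
        ∑ x ∈ antidiagonal (u + 1),
          ((x.1 : ℂ) * ((Ring.choose p x.1 : ℤ) * (x.2.factorial : ℂ)⁻¹)) •
          (act P (ω : V) 0 ^ x.2) (act P a (p - x.1) v) := by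
      rw [smul_sum, ← sum_add_distrib]
      refine sum_congr rfl fun x hx => ?_
      have hx' := congrArg (Nat.cast : ℕ → ℂ) (HasAntidiagonal.mem_antidiagonal.1 hx)
      push_cast at hx'
      rw [smul_smul, ← add_smul, ← hx']
      congr 1; ring
    refine smul_right_injective P hu ?_
    simp only
    rw [h1, h2, Nat.sum_antidiagonal_succ', Nat.sum_antidiagonal_succ]
    simp only [Nat.cast_zero, zero_mul, zero_smul, zero_add]
    rw [← sum_add_distrib]
    refine sum_congr rfl fun x _ => ?_
    rw [smul_add, smul_smul]
    congr 2
    · rw [Nat.factorial_succ]; push_cast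
      have : ((x.2 : ℂ) + 1) ≠ 0 := by exact_mod_cast Nat.succ_ne_zero x.2
      field_simp
    · have h3 := congrArg (Int.cast : ℤ → ℂ) (succ_mul_choose_succ p x.1)
      have h4 := congrArg (Int.cast : ℤ → ℂ) (choose_mul_choose_sub p x.1 1)
      simp only [Ring.choose_one_right] at h4
      push_cast at h3 h4 ⊢
      linear_combination (x.2.factorial : ℂ)⁻¹ * (h4 - h3)

end

namespace TruncSeries

open Finset

section

variable [WeakModule V P]

variable (V) in
/-- The map `Φ ↦ e^{-x L(-1)} Φ(x) z`. -/
def translate (z : N) : TruncSeries N P →ₗ[ℂ] (ℂ → P) where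
  toFun Φ γ := ∑ᶠ s : ℕ,
    ((-1 : ℂ) ^ s * (s.factorial : ℂ)⁻¹) • (act P (ω : V) 0 ^ s) (Φ.1 (γ + s) z)
  map_add' Φ Ψ := funext fun γ => by
    obtain ⟨K, hK⟩ := Φ.2.exists_nat γ z
    obtain ⟨K', hK'⟩ := Ψ.2.exists_nat γ z
    rw [Pi.add_apply,
      finsum_eq_sum_range (K := K + K') fun i hi => by
        simp [hK i (by omega), hK' i (by omega)],
      finsum_eq_sum_range (K := K + K') fun i hi => by simp [hK i (by omega)],
      finsum_eq_sum_range (K := K + K') fun i hi => by simp [hK' i (by omega)],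
      ← sum_add_distrib]
    simp
  map_smul' c Φ := funext fun γ => by
    obtain ⟨K, hK⟩ := Φ.2.exists_nat γ z
    rw [RingHom.id_apply, Pi.smul_apply,
      finsum_eq_sum_range (K := K) fun i hi => by simp [hK i hi],
      finsum_eq_sum_range (K := K) fun i hi => by simp [hK i hi], smul_sum]
    simp [smul_comm c]

theorem translate_eq_sum (Φ : TruncSeries N P) {z : N} {γ : ℂ} {K : ℕ}
    (hK : ∀ i : ℕ, K ≤ i → Φ.1 (γ + i) z = 0) :
    translate V z Φ γ = ∑ s ∈ Finset.range K,
      ((-1 : ℂ) ^ s * (s.factorial : ℂ)⁻¹) • (act P (ω : V) 0 ^ s) (Φ.1 (γ + s) z) :=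
  finsum_eq_sum_range fun i hi => by rw [hK i hi, map_zero, smul_zero]

theorem translate_eq_zero (Φ : TruncSeries N P) {z : N} {γ : ℂ}
    (hK : ∀ i : ℕ, Φ.1 (γ + i) z = 0) : translate V z Φ γ = 0 := by
  rw [translate_eq_sum Φ (K := 0) fun i _ => hK i]; simp

theorem translate_shift (z : N) (Φ : TruncSeries N P) (γ : ℂ) :
    translate V z (shift Φ) γ = translate V z Φ (γ + 1) := by
  simp only [translate, LinearMap.coe_mk, AddHom.coe_mk, shift_apply,
    add_right_comm]

/-- `e^{-x L(-1)} Y(a, x₁ + x) = Y(a, x₁) e^{-x L(-1)}`, in components. -/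
theorem translate_left (a : V) (p : ℤ) (z : N) (Φ : TruncSeries N P) (γ : ℂ) :
    translate V z (left a p 0 Φ) γ = act P a p (translate V z Φ γ) := by
  obtain ⟨K, hK⟩ := Φ.2.exists_nat γ z
  have hK' : ∀ i j : ℕ, K ≤ i + j → Φ.1 (γ + i + j) z = 0 := fun i j hij => by
    rw [add_assoc, ← Nat.cast_add, hK _ hij]
  have h1 : ∀ i : ℕ, (left a p 0 Φ).1 (γ + i) z =
      ∑ j ∈ range K, altChoose p j • act P a (0 + p - j) (Φ.1 (γ + i + j) z) := fun i =>
    left_apply_eq_sum a p 0 Φ (K := K) fun j hj => hK' i j (by omega)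
  rw [translate_eq_sum Φ hK, translate_eq_sum _ (K := K) fun i hi => by
    rw [h1, sum_eq_zero]; intro j _; rw [hK' i j (by omega), map_zero, smul_zero]]
  simp only [h1, map_sum, smul_sum]
  rw [sum_range_sum_range_eq_antidiagonal _ K fun i j hij => by
    rw [hK' i j hij, map_zero, smul_zero, map_zero, smul_zero]]
  refine sum_congr rfl fun d _ => ?_
  rw [map_smul, mul_smul, act_omega_zero_pow, smul_sum,
    ← Nat.sum_antidiagonal_swap (n := d) (f := fun p : ℕ × ℕ => _ • _)]
  refine sum_congr rfl fun x hx => ?_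
  have hx' := HasAntidiagonal.mem_antidiagonal.1 hx
  rw [Prod.fst_swap, Prod.snd_swap, map_zsmul, ← Int.cast_smul_eq_zsmul ℂ, smul_smul, smul_smul,
    add_assoc γ, ← Nat.cast_add, add_comm x.2, hx', zero_add]
  congr 1
  rw [← hx', altChoose]
  push_cast; ring

/-- `e^{-x L(-1)}` is injective on truncated series. -/
theorem eq_zero_of_translate (Φ : TruncSeries N P) (z : N) (h : translate V z Φ = 0) (γ : ℂ) :
    Φ.1 γ z = 0 := by
  obtain ⟨K, hK⟩ := Φ.2.exists_nat γ z
  have : ∀ k : ℕ, ∀ i : ℕ, K ≤ i + k → Φ.1 (γ + i) z = 0 := by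
    intro k
    induction k with
    | zero => intro i hi; exact hK i (by simpa using hi)
    | succ k ih =>
      intro i hi
      have h1 := congrFun h (γ + i)
      rw [translate_eq_sum Φ (K := 1) fun j hj => by
        rw [add_assoc, ← Nat.cast_add]; exact ih (i + j) (by omega)] at h1
      simpa using h1
  simpa using this K 0 (by simp)

end

end TruncSeries
end VertexOperatorAlgebra

/-! ### Multiplication by powers of `x₁ + x` and `x₂ + x` -/

section TwoVariables

variable {X Y : Type*} [AddCommGroup X] [Module ℂ X] [AddCommGroup Y] [Module ℂ Y]

/-- Multiplication by `x₁ + x` of `∑ F_{m,n} x₁^{-m-1} x₂^{-n-1}`, where `S` is the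
multiplication by `x` on the coefficients. -/
def mulFst (S : Module.End ℂ X) : Module.End ℂ (ℤ → ℤ → X) where
  toFun F m n := F (m + 1) n + S (F m n)
  map_add' F G := by funext m n; simp only [Pi.add_apply, map_add]; abel
  map_smul' c F := by funext m n; simp

/-- Multiplication by `x₂ + x`. -/
def mulSnd (S : Module.End ℂ X) : Module.End ℂ (ℤ → ℤ → X) where
  toFun F m n := F m (n + 1) + S (F m n)
  map_add' F G := by funext m n; simp only [Pi.add_apply, map_add]; abel
  map_smul' c F := by funext m n; simp

/-- Multiplication by `(x₁ + x)^R (x₂ + x)^{R'}`. -/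
def mulPow (S : Module.End ℂ X) (R R' : ℕ) : Module.End ℂ (ℤ → ℤ → X) :=
  mulFst S ^ R * mulSnd S ^ R'

theorem mulFst_pow_eq {S : Module.End ℂ X} (G : ℕ → ℤ → ℤ → X)
    (hG : ∀ R m n, G (R + 1) m n = G R (m + 1) n + S (G R m n)) (R : ℕ) :
    (mulFst S ^ R) (G 0) = G R := by
  induction R with
  | zero => rfl
  | succ R ih =>
    rw [pow_succ', Module.End.mul_apply, ih]
    funext m n; exact (hG R m n).symm

theorem mulSnd_pow_eq {S : Module.End ℂ X} (G : ℕ → ℤ → ℤ → X)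
    (hG : ∀ R m n, G (R + 1) m n = G R m (n + 1) + S (G R m n)) (R : ℕ) :
    (mulSnd S ^ R) (G 0) = G R := by
  induction R with
  | zero => rfl
  | succ R ih =>
    rw [pow_succ', Module.End.mul_apply, ih]
    funext m n; exact (hG R m n).symm

theorem mulPow_eq {S : Module.End ℂ X} (G : ℕ → ℕ → ℤ → ℤ → X)
    (h₁ : ∀ R R' m n, G (R + 1) R' m n = G R R' (m + 1) n + S (G R R' m n))
    (h₂ : ∀ R' m n, G 0 (R' + 1) m n = G 0 R' m (n + 1) + S (G 0 R' m n)) (R R' : ℕ) :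
    mulPow S R R' (G 0 0) = G R R' := by
  rw [mulPow, Module.End.mul_apply, mulSnd_pow_eq (G 0) h₂,
    mulFst_pow_eq (fun R => G R R') fun R => h₁ R R']

theorem map_mulFst_pow {S : Module.End ℂ X} {T : Module.End ℂ Y} (Ω : X →ₗ[ℂ] Y)
    (hΩ : ∀ x, Ω (S x) = T (Ω x)) (R : ℕ) (F : ℤ → ℤ → X) (m n : ℤ) :
    Ω ((mulFst S ^ R) F m n) = (mulFst T ^ R) (fun m n => Ω (F m n)) m n := by
  induction R generalizing m n with
  | zero => rfl
  | succ R ih =>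
    rw [pow_succ', pow_succ', Module.End.mul_apply, Module.End.mul_apply]
    simp only [mulFst, LinearMap.coe_mk, AddHom.coe_mk, map_add, hΩ] at ih ⊢
    rw [ih, ih]

theorem map_mulSnd_pow {S : Module.End ℂ X} {T : Module.End ℂ Y} (Ω : X →ₗ[ℂ] Y)
    (hΩ : ∀ x, Ω (S x) = T (Ω x)) (R : ℕ) (F : ℤ → ℤ → X) (m n : ℤ) :
    Ω ((mulSnd S ^ R) F m n) = (mulSnd T ^ R) (fun m n => Ω (F m n)) m n := by
  induction R generalizing m n with
  | zero => rfl
  | succ R ih =>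
    rw [pow_succ', pow_succ', Module.End.mul_apply, Module.End.mul_apply]
    simp only [mulSnd, LinearMap.coe_mk, AddHom.coe_mk, map_add, hΩ] at ih ⊢
    rw [ih, ih]

theorem map_mulPow {S : Module.End ℂ X} {T : Module.End ℂ Y} (Ω : X →ₗ[ℂ] Y)
    (hΩ : ∀ x, Ω (S x) = T (Ω x)) (R R' : ℕ) (F : ℤ → ℤ → X) (m n : ℤ) :
    Ω (mulPow S R R' F m n) = mulPow T R R' (fun m n => Ω (F m n)) m n := by
  rw [mulPow, Module.End.mul_apply, map_mulFst_pow Ω hΩ]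
  simp only [map_mulSnd_pow Ω hΩ]
  rfl

/-- Multiplication by `x` on series `∑ v_γ x^{-γ-1}`. -/
def seriesShift : Module.End ℂ (ℂ → X) := LinearMap.funLeft ℂ X (· + 1)

theorem seriesShift_apply (v : ℂ → X) (γ : ℂ) : seriesShift v γ = v (γ + 1) := rfl

theorem mulPow_eq_zero {m₀ n₀ : ℤ} {γ₀ : ℂ} (R R' : ℕ) {F : ℤ → ℤ → ℂ → X}
    (hF : ∀ m n, m₀ ≤ m → n₀ ≤ n → ∀ i : ℕ, F m n (γ₀ + i) = 0) :
    mulPow seriesShift R R' F m₀ n₀ γ₀ = 0 := by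
  have e : ∀ i : ℕ, γ₀ + (i : ℂ) + 1 = γ₀ + ((i + 1 : ℕ) : ℂ) := fun i => by push_cast; ring
  have h2 : ∀ m n, m₀ ≤ m → n₀ ≤ n → ∀ i : ℕ, (mulSnd seriesShift ^ R') F m n (γ₀ + i) = 0 := by
    induction R' with
    | zero => exact hF
    | succ R' ih =>
      intro m n hm hn i
      rw [pow_succ', Module.End.mul_apply]
      simp only [mulSnd, LinearMap.coe_mk, AddHom.coe_mk, Pi.add_apply, seriesShift_apply, e]
        at ih ⊢
      rw [ih m (n + 1) hm (by omega), ih m n hm hn, add_zero]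
  have h1 : ∀ m n, m₀ ≤ m → n₀ ≤ n → ∀ i : ℕ,
      mulPow seriesShift R R' F m n (γ₀ + i) = 0 := by
    simp only [mulPow, Module.End.mul_apply]
    induction R with
    | zero => exact h2
    | succ R ih =>
      intro m n hm hn i
      rw [pow_succ', Module.End.mul_apply]
      simp only [mulFst, LinearMap.coe_mk, AddHom.coe_mk, Pi.add_apply, seriesShift_apply, e]
        at ih ⊢
      rw [ih (m + 1) n (by omega) hn, ih m n hm hn, add_zero]
  simpa using h1 m₀ n₀ le_rfl le_rfl 0

/-- Multiplication by `x₁ + x` of a series in one variable `x₁`. -/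
def mulOne (S : Module.End ℂ X) (g : ℤ → X) : ℤ → X := fun k => g (k + 1) + S (g k)

theorem mulPow_of_add (S : Module.End ℂ X) (R R' : ℕ) (g : ℤ → X) :
    mulPow S R R' (fun m n => g (m + n)) = fun m n => (mulOne S)^[R + R'] g (m + n) := by
  have h2 := mulSnd_pow_eq (S := S) (fun R' m n => (mulOne S)^[R'] g (m + n))
    (fun R' m n => by rw [Function.iterate_succ_apply', ← add_assoc]; rfl) R'
  have h1 := mulFst_pow_eq (S := S) (fun R m n => (mulOne S)^[R + R'] g (m + n))
    (fun R m n => by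
      rw [add_right_comm R 1, Function.iterate_succ_apply', add_right_comm m 1]; rfl) R
  rw [mulPow, Module.End.mul_apply]
  simp only [Function.iterate_zero, id_eq, zero_add] at h1 h2
  rw [h2, h1]

/-- Multiplication by `x₁ + x` is injective on series with finitely many negative powers of
`x₁`. -/
theorem eq_zero_of_mulOne_iterate {S : Module.End ℂ X} (hS : Function.Injective S) (Q : ℕ)
    {g : ℤ → X} {K : ℤ} (hg : ∀ k, K ≤ k → g k = 0) (h : (mulOne S)^[Q] g = 0) : g = 0 := by
  induction Q generalizing g with
  | zero => exact h
  | succ Q ih =>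
    have h1 : mulOne S g = 0 := ih (fun k hk => by simp [mulOne, hg k hk, hg (k + 1) (by omega)])
      (by rwa [Function.iterate_succ_apply] at h)
    have h2 : ∀ (j : ℕ) (k : ℤ), K ≤ k + j → g k = 0 := by
      intro j
      induction j with
      | zero => intro k hk; exact hg k (by simpa using hk)
      | succ j ihj =>
        intro k hk
        have h3 := congrFun h1 k
        rw [mulOne, ihj (k + 1) (by push_cast at hk; omega), zero_add] at h3
        exact hS (by rw [map_zero]; exact h3)
    funext k
    exact h2 (K - k).toNat k (by omega)

end TwoVariables

namespace VertexOperatorAlgebra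

variable {V : Type u} [AddCommGroup V] [Module ℂ V] [VertexOperatorAlgebra V]
variable {N : Type v} {P : Type w} [AddCommGroup N] [Module ℂ N] [AddCommGroup P] [Module ℂ P]

section

variable [WeakModule V P]

/-- The coefficient of `x₁^{-p-1}` in `(x₁ + x)^R Y_P(c, x₁)`, acting on series in `x`. -/
def actPow (c : V) : ℕ → ℤ → Module.End ℂ (ℂ → P)
  | 0, p => (act P c p).compLeft ℂ
  | R + 1, p => actPow c R (p + 1) + seriesShift * actPow c R p

theorem actPow_succ (c : V) (R : ℕ) (p : ℤ) (v : ℂ → P) :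
    actPow c (R + 1) p v = actPow c R (p + 1) v + seriesShift (actPow c R p v) := rfl

theorem actPow_shift (c : V) (R : ℕ) (p : ℤ) (v : ℂ → P) :
    actPow c R p (seriesShift v) = seriesShift (actPow c R p v) := by
  induction R generalizing p with
  | zero => rfl
  | succ R ih => rw [actPow_succ, actPow_succ, ih, ih, map_add]

end

namespace TruncSeries

open Finset

section

variable [WeakModule V P]

theorem translate_shift' (z : N) (Φ : TruncSeries N P) :
    translate V z (shift Φ) = seriesShift (translate V z Φ) :=
  funext fun γ => translate_shift z Φ γ

theorem translate_left_pow (c : V) (p : ℤ) (R : ℕ) (z : N) (Φ : TruncSeries N P) :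
    translate V z (left c p R Φ) = actPow c R p (translate V z Φ) := by
  induction R generalizing p with
  | zero => exact funext fun γ => translate_left c p z Φ γ
  | succ R ih =>
    have h := left_succ c p R Φ
    rw [eq_sub_iff_add_eq] at h
    rw [Nat.cast_succ, ← h, map_add, translate_shift', ih, ih, actPow_succ]

theorem translate_congr {Φ Ψ : TruncSeries N P} {z : N} (h : ∀ γ, Φ.1 γ z = Ψ.1 γ z) :
    translate V z Φ = translate V z Ψ := by
  funext γ
  simp only [translate, LinearMap.coe_mk, AddHom.coe_mk, h]

end

variable [WeakModule V N] [WeakModule V P]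

/-- Weak associativity, in terms of `e^{-x L(-1)} Φ(x) z`. -/
theorem translate_op_pow (c : V) (p : ℤ) {R : ℕ} {z : N} (hR : ∀ i : ℕ, act N c (R + i) z = 0)
    (Φ : TruncSeries N P) :
    translate V z (op c p R Φ) = actPow c R p (translate V z Φ) := by
  rw [← translate_left_pow]
  refine translate_congr fun γ => ?_
  rw [op_coeff, right_apply_eq_sum c p R Φ γ (K := 0) fun i _ => hR i]
  simp

theorem op_add_one (c : V) (p : ℤ) (R : ℕ) (Φ : TruncSeries N P) :
    op c p (R + 1 : ℕ) Φ = op c (p + 1) R Φ + shift (op c p R Φ) := by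
  have h := op_succ c p R Φ
  rw [eq_sub_iff_add_eq] at h
  rw [h, Nat.cast_succ]

/-- Two applications of weak associativity, for the product `a_{m+k} b_{n+k'}`. -/
theorem translate_mulPow_op_op (a b : V) (k k' : ℤ) {R R' : ℕ} {z : N}
    (hR : ∀ i : ℕ, act N a (R + i) z = 0) (hR' : ∀ i : ℕ, act N b (R' + i) z = 0)
    (Φ : TruncSeries N P) (m n : ℤ) :
    translate V z (mulPow shift R R' (fun m n => op a (m + k) 0 (op b (n + k') 0 Φ)) m n) =
      mulPow seriesShift R R' (fun m n => actPow a 0 (m + k)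
        (actPow b 0 (n + k') (translate V z Φ))) m n := by
  have h1 := mulPow_eq (S := shift) (fun R R' m n => op a (m + k) R (op b (n + k') R' Φ))
    (fun R R' m n => by rw [op_add_one, add_right_comm])
    (fun R' m n => by rw [op_add_one, map_add, op_shift, add_right_comm]) R R'
  have h2 := mulPow_eq (S := seriesShift)
    (fun R R' m n => actPow a R (m + k) (actPow b R' (n + k') (translate V z Φ)))
    (fun R R' m n => by rw [actPow_succ, add_right_comm])
    (fun R' m n => by rw [actPow_succ, map_add, actPow_shift, add_right_comm]) R R'
  simp only [Nat.cast_zero] at h1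
  rw [h1, h2, translate_op_pow a _ hR, translate_op_pow b _ hR']

/-- Two applications of weak associativity, for the product `b_{n+k} a_{m+k'}`. -/
theorem translate_mulPow_op_op' (a b : V) (k k' : ℤ) {R R' : ℕ} {z : N}
    (hR : ∀ i : ℕ, act N a (R + i) z = 0) (hR' : ∀ i : ℕ, act N b (R' + i) z = 0)
    (Φ : TruncSeries N P) (m n : ℤ) :
    translate V z (mulPow shift R R' (fun m n => op b (n + k) 0 (op a (m + k') 0 Φ)) m n) =
      mulPow seriesShift R R' (fun m n => actPow b 0 (n + k)
        (actPow a 0 (m + k') (translate V z Φ))) m n := by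
  have h1 := mulPow_eq (S := shift) (fun R R' m n => op b (n + k) R' (op a (m + k') R Φ))
    (fun R R' m n => by rw [op_add_one, map_add, op_shift, add_right_comm])
    (fun R' m n => by rw [op_add_one, add_right_comm]) R R'
  have h2 := mulPow_eq (S := seriesShift)
    (fun R R' m n => actPow b R' (n + k) (actPow a R (m + k') (translate V z Φ)))
    (fun R R' m n => by rw [actPow_succ, map_add, actPow_shift, add_right_comm])
    (fun R' m n => by rw [actPow_succ, add_right_comm]) R R'
  simp only [Nat.cast_zero] at h1
  rw [h1, h2, translate_op_pow b _ hR', translate_op_pow a _ hR]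

/-- Weak associativity for the modes `c_{m+n-i}`. Multiplication by `(x₂ + x)^{R'}` suffices, since
these depend on `n` through `m + n - i`. -/
theorem translate_mulPow_op (c : V) (i : ℕ) (R : ℕ) {R' : ℕ} {z : N}
    (hR' : ∀ i : ℕ, act N c (R' + i) z = 0) (Φ : TruncSeries N P) (m n : ℤ) :
    translate V z (mulPow shift R R'
        (fun m n => Ring.choose m i • op c (m + n - i) 0 Φ) m n) =
      mulPow seriesShift R R' (fun m n => Ring.choose m i •
        actPow c 0 (m + n - i) (translate V z Φ)) m n := by
  have h1 := mulSnd_pow_eq (S := shift) (fun R' m n => Ring.choose m i • op c (m + n - i) R' Φ)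
    (fun R' m n => by
      rw [op_add_one, smul_add, map_zsmul, ← add_assoc, sub_add_eq_add_sub]) R'
  have h2 := mulSnd_pow_eq (S := seriesShift)
    (fun R' m n => Ring.choose m i • actPow c R' (m + n - i) (translate V z Φ))
    (fun R' m n => by
      rw [actPow_succ, smul_add, map_zsmul, ← add_assoc, sub_add_eq_add_sub]) R'
  simp only [Nat.cast_zero] at h1
  rw [mulPow, mulPow, Module.End.mul_apply, Module.End.mul_apply, h1, h2,
    map_mulFst_pow (T := seriesShift) _ fun x => translate_shift' z x]
  simp only [map_zsmul, translate_op_pow c _ hR']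

end TruncSeries
end VertexOperatorAlgebra

/-! ### The Jacobi identity on generalized intertwining operators -/

namespace VertexOperatorAlgebra

variable {V : Type u} [AddCommGroup V] [Module ℂ V] [VertexOperatorAlgebra V]
variable {N : Type v} {P : Type w} [AddCommGroup N] [Module ℂ N] [AddCommGroup P] [Module ℂ P]

namespace TruncSeries

open Finset

variable [WeakModule V N] [WeakModule V P]

/-- The difference of the two sides of the Jacobi identity for `a` and `b`, applied to `Φ`. -/
def jacobiDefect (a b : V) (Φ : TruncSeries N P) (l m n : ℤ) : TruncSeries N P :=
  expandMul (fun p q => op a p 0 (op b q 0 Φ)) l m n -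
    (l.negOnePow : ℤ) • expandMul (fun q p => op b q 0 (op a p 0 Φ)) l n m -
      ∑ᶠ i : ℕ, Ring.choose m i • op (mode a (l + i) b) (m + n - i) 0 Φ

theorem IsLocalWith.exists_nat {b : V} {Φ : TruncSeries N P} (h : IsLocalWith b Φ) (n₀ : ℤ) :
    ∃ K : ℕ, ∀ i : ℕ, K ≤ i → ∀ n, n₀ ≤ n → op b (n + i) 0 Φ = 0 := by
  obtain ⟨L, hL⟩ := h
  exact ⟨(L - n₀).toNat, fun i hi n hn => hL _ (by omega) _⟩

theorem truncRight_op_op (a : V) {b : V} {Φ : TruncSeries N P} (h : IsLocalWith b Φ) :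
    TruncRight fun (p q : ℤ) => op a p 0 (op b q 0 Φ) := fun n => by
  obtain ⟨K, hK⟩ := h.exists_nat n
  exact ⟨K, fun i hi m => by
    have := hK i hi n le_rfl
    simp only [this, map_zero]⟩

theorem jacobiDefect_succ {a b : V} {Φ : TruncSeries N P} (ha : IsLocalWith a Φ)
    (hb : IsLocalWith b Φ) (l m n : ℤ) :
    jacobiDefect a b Φ (l + 1) m n =
      jacobiDefect a b Φ l (m + 1) n - jacobiDefect a b Φ l m (n + 1) := by
  obtain ⟨L, hL⟩ := exists_mode_eq_zero a b
  have h := finsum_choose_succ (Γ := ℤ) (f := fun l n => op (mode a l b) n 0 Φ) (L := L)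
    (fun l hl n => by rw [hL l hl, op_zero]; rfl) l m n
  simp only [Int.cast_id] at h
  rw [jacobiDefect, h, expandMul_succ (truncRight_op_op a hb), expandMul_succ
    (truncRight_op_op b ha), Int.negOnePow_succ, Units.val_neg, neg_smul, smul_sub, jacobiDefect,
    jacobiDefect]
  abel

theorem jacobiDefect_zero (a b : V) (Φ : TruncSeries N P) (m n : ℤ) :
    jacobiDefect a b Φ 0 m n = 0 := by
  obtain ⟨M, hM⟩ := exists_nat_mode_eq_zero' a b
  rw [jacobiDefect, expandMul_zero, expandMul_zero, finsum_eq_sum_range (K := M) fun i hi => by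
    rw [zero_add, hM i hi, op_zero, LinearMap.zero_apply, smul_zero], Int.negOnePow_zero,
    Units.val_one, one_smul, op_commutator a b m n 0 Φ hM]
  simp

/-- A finite form of the Jacobi identity on a weak module, for a given range of indices. -/
theorem jacobi_finite (a b : V) (l m n : ℤ) (v : P) {K : ℕ}
    (ha : ∀ i : ℕ, K ≤ i → act P a (m + i) v = 0) (hb : ∀ i : ℕ, K ≤ i → act P b (n + i) v = 0)
    (hab : ∀ i : ℕ, K ≤ i → mode a (l + i) b = 0) :
    ∑ i ∈ range K, (altChoose l i • act P a (m + (l - i)) (act P b (n + i) v) -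
      ((l.negOnePow : ℤ) * altChoose l i) • act P b (n + (l - i)) (act P a (m + i) v) -
      Ring.choose m i • act P (mode a (l + i) b) (m + n - i) v) = 0 := by
  have h := WeakModule.jacobi (M := P) a b l m n v
  rw [finsum_eq_sum_range (K := K) fun i hi => by
      have := hb i hi
      simp only [act] at this
      rw [this, map_zero, smul_zero],
    finsum_eq_sum_range (K := K) fun i hi => by
      have := ha i hi
      simp only [act] at this
      rw [this, map_zero, smul_zero],
    finsum_eq_sum_range (K := K) fun i hi => by
      simp only [hab i hi, map_zero, Pi.zero_apply, LinearMap.zero_apply, smul_zero]] at h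
  rw [sum_sub_distrib, sum_sub_distrib, sub_eq_zero]
  refine Eq.trans ?_ h
  simp only [smul_sum, smul_smul, ← add_sub_assoc]
  rfl

/-- The defect of the Jacobi identity becomes zero under multiplication by
`(x₁ + x)^R (x₂ + x)^{R'}` and `e^{-x L(-1)}`, for powers that depend on `z`: by weak associativity the two operations turn it
into the defect of the Jacobi identity on `P`. -/
theorem translate_mulPow_jacobiDefect {a b : V} {Φ : TruncSeries N P} (ha : IsLocalWith a Φ)
    (hb : IsLocalWith b Φ) (l : ℤ) (z : N) :
    ∃ R R' : ℕ, ∀ m n, translate V z (mulPow shift R R' (jacobiDefect a b Φ l) m n) = 0 := by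
  obtain ⟨M, hM⟩ := exists_nat_mode_eq_zero a b l
  obtain ⟨R, hR⟩ := exists_nat_act_eq_zero N a 0 z
  obtain ⟨R₁, hR₁⟩ := exists_nat_act_eq_zero N b 0 z
  choose R₂ hR₂ using fun i : ℕ => exists_nat_act_eq_zero N (mode a (l + i) b) 0 z
  obtain ⟨B, hB⟩ := ((Finset.range M).image R₂).bddAbove
  simp only [zero_add] at hR hR₁ hR₂
  set R' := R₁ + B
  have hRa : ∀ i : ℕ, act N a (R + i) z = 0 := fun i => by
    rw [← Nat.cast_add]; exact hR _ (by omega)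
  have hRb : ∀ i : ℕ, act N b (R' + i) z = 0 := fun i => by
    rw [← Nat.cast_add]; exact hR₁ _ (by omega)
  have hRc : ∀ j i : ℕ, act N (mode a (l + j) b) (R' + i) z = 0 := fun j i => by
    by_cases hj : M ≤ j
    · rw [hM j hj]; simp
    · have : R₂ j ≤ B := hB (by simpa using ⟨j, not_le.1 hj, rfl⟩)
      rw [← Nat.cast_add]; exact hR₂ j _ (by omega)
  refine ⟨R, R', fun m₀ n₀ => funext fun γ₀ => ?_⟩
  set v := translate V z Φ with hv
  -- `v` is truncated, so that one bound `K` for the number of terms serves all the coefficients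
  -- which enter into the coefficient at `(m₀, n₀, γ₀)`.
  obtain ⟨K₁, hK₁⟩ := Φ.2.exists_nat γ₀ z
  have hvK : ∀ k : ℕ, K₁ ≤ k → v (γ₀ + k) = 0 := fun k hk =>
    translate_eq_zero Φ fun i => by
      rw [add_assoc, ← Nat.cast_add]; exact hK₁ _ (by omega)
  have hact : ∀ (c : V) (p₀ : ℤ), ∃ K : ℕ, ∀ i : ℕ, K ≤ i → ∀ p, p₀ ≤ p → ∀ k : ℕ,
      act P c (p + i) (v (γ₀ + k)) = 0 := fun c p₀ => by
    choose K hK using fun k : ℕ => exists_nat_act_eq_zero P c p₀ (v (γ₀ + k))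
    obtain ⟨B, hB⟩ := ((Finset.range K₁).image K).bddAbove
    refine ⟨B, fun i hi p hp k => ?_⟩
    by_cases hk : K₁ ≤ k
    · rw [hvK k hk, map_zero]
    · have : K k ≤ B := hB (by simpa using ⟨k, not_le.1 hk, rfl⟩)
      have h := hK k (i + (p - p₀).toNat) (by omega)
      rwa [show p₀ + ((i + (p - p₀).toNat : ℕ) : ℤ) = p + i by omega] at h
  obtain ⟨Ka, hKa⟩ := hact a m₀
  obtain ⟨Kb, hKb⟩ := hact b n₀
  obtain ⟨La, hLa⟩ := ha.exists_nat m₀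
  obtain ⟨Lb, hLb⟩ := hb.exists_nat n₀
  obtain ⟨K, hK⟩ : ∃ K, K = Ka + Kb + La + Lb + M := ⟨_, rfl⟩
  let F : ℤ → ℤ → TruncSeries N P := ∑ i ∈ range K,
    (altChoose l i • (fun m n => op a (m + (l - i)) 0 (op b (n + i) 0 Φ)) -
      ((l.negOnePow : ℤ) * altChoose l i) •
        (fun m n => op b (n + (l - i)) 0 (op a (m + i) 0 Φ)) -
      (fun m n => Ring.choose m i • op (mode a (l + i) b) (m + n - i) 0 Φ))
  let F' : ℤ → ℤ → ℂ → P := ∑ i ∈ range K,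
    (altChoose l i • (fun m n => actPow a 0 (m + (l - i)) (actPow b 0 (n + i) v)) -
      ((l.negOnePow : ℤ) * altChoose l i) •
        (fun m n => actPow b 0 (n + (l - i)) (actPow a 0 (m + i) v)) -
      (fun m n => Ring.choose m i • actPow (mode a (l + i) b) 0 (m + n - i) v))
  have hF : ∀ m n, m₀ ≤ m → n₀ ≤ n → jacobiDefect a b Φ l m n = F m n := by
    intro m n hm hn
    rw [jacobiDefect, expandMul, finsum_eq_sum_range (K := K) fun i hi => by
        have := hLb i (by omega) n hn
        simp only [this, map_zero, smul_zero],
      expandMul, finsum_eq_sum_range (K := K) fun i hi => by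
        have := hLa i (by omega) m hm
        simp only [this, map_zero, smul_zero],
      finsum_eq_sum_range (K := K) fun i hi => by
        rw [hM i (by omega), op_zero, LinearMap.zero_apply, smul_zero],
      smul_sum, ← sum_sub_distrib, ← sum_sub_distrib]
    simp only [F, Finset.sum_apply, Pi.sub_apply, Pi.smul_apply, smul_smul, ← add_sub_assoc]
    rfl
  have hF' : ∀ m n, m₀ ≤ m → n₀ ≤ n → ∀ k : ℕ, F' m n (γ₀ + k) = 0 := by
    intro m n hm hn k
    rw [← jacobi_finite a b l m n (v (γ₀ + k)) (K := K)
      (fun i hi => hKa i (by omega) m hm k) (fun i hi => hKb i (by omega) n hn k)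
      (fun i hi => hM i (by omega))]
    simp only [F', Finset.sum_apply, Pi.sub_apply, Pi.smul_apply]
    rfl
  have hrel : translate V z (mulPow shift R R' F m₀ n₀) =
      mulPow seriesShift R R' F' m₀ n₀ := by
    simp only [F, F', map_sum, map_sub, map_zsmul, Finset.sum_apply, Pi.sub_apply, Pi.smul_apply]
    refine sum_congr rfl fun i _ => ?_
    rw [translate_mulPow_op_op a b _ _ hRa hRb, translate_mulPow_op_op' a b _ _ hRa hRb,
      translate_mulPow_op _ i R (hRc i)]
  have h1 : mulPow seriesShift R R' (fun m n => translate V z (jacobiDefect a b Φ l m n)) m₀ n₀ γ₀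
      = mulPow seriesShift R R' (fun m n => translate V z (F m n)) m₀ n₀ γ₀ := by
    rw [← sub_eq_zero, ← Pi.sub_apply, ← Pi.sub_apply, ← Pi.sub_apply, ← map_sub]
    refine mulPow_eq_zero R R' fun m n hm hn i => ?_
    simp only [Pi.sub_apply, hF m n hm hn, sub_self]
  have hsh : ∀ x : TruncSeries N P, translate V z (shift x) = seriesShift (translate V z x) :=
    translate_shift' z
  rw [map_mulPow _ hsh, h1, ← map_mulPow _ hsh, hrel, mulPow_eq_zero R R' hF']
  rfl

/-- The Jacobi identity for the action of `V` on generalized intertwining operators. For `l ≥ 0` it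
follows from the commutator formula. If it holds for `l + 1`, then the defect for `l` is a function
of `m + n` that vanishes for large arguments, on which multiplication by `x₁ + x` is injective. -/
theorem jacobiDefect_eq_zero {Φ : TruncSeries N P} (hΦ : ∀ a : V, IsLocalWith a Φ) (a b : V)
    (l m n : ℤ) : jacobiDefect a b Φ l m n = 0 := by
  have hsucc := jacobiDefect_succ (hΦ a) (hΦ b)
  have hdesc : ∀ l, (∀ m n, jacobiDefect a b Φ (l + 1) m n = 0) →
      ∀ m n, jacobiDefect a b Φ l m n = 0 := by
    intro l hl
    have hstep : ∀ m n, jacobiDefect a b Φ l (m + 1) n = jacobiDefect a b Φ l m (n + 1) :=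
      fun m n => sub_eq_zero.1 ((hsucc l m n).symm.trans (hl m n))
    have hadd : ∀ m n, jacobiDefect a b Φ l m n = jacobiDefect a b Φ l 0 (m + n) := by
      intro m
      induction m using Int.induction_on with
      | zero => intro n; rw [zero_add]
      | succ m ih => intro n; rw [hstep, ih]; congr 1; ring
      | pred m ih =>
        intro n
        have := hstep (-m - 1) (n - 1)
        rw [sub_add_cancel, sub_add_cancel] at this
        rw [← this, ih]; congr 1; ring
    obtain ⟨M, hM⟩ := exists_nat_mode_eq_zero a b l
    obtain ⟨La, hLa⟩ := hΦ a
    obtain ⟨Lb, hLb⟩ := hΦ b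
    choose Lc hLc using fun i : ℕ => hΦ (mode a (l + i) b)
    obtain ⟨B, hB⟩ := ((Finset.range M).image Lc).bddAbove
    have hlarge : ∀ k : ℤ, La + max Lb (B + M - La) ≤ k →
        jacobiDefect a b Φ l 0 k = 0 := by
      intro k hk
      have hk1 : Lb ≤ k - La := by have := le_max_left Lb (B + M - La); omega
      have hk2 : B + M ≤ k := by have := le_max_right Lb (B + M - La); omega
      rw [show k = La + (k - La) by ring, ← hadd, jacobiDefect,
        expandMul, finsum_eq_sum_range (K := 0) fun i _ => by
          have := hLb (k - La + i) (by omega) 0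
          simp only [this, map_zero, smul_zero],
        expandMul, finsum_eq_sum_range (K := 0) fun i _ => by
          have := hLa (La + i) (by omega) 0
          simp only [this, map_zero, smul_zero],
        finsum_eq_sum_range (K := 0) fun i _ => by
          by_cases hi : M ≤ i
          · rw [hM i hi, op_zero, LinearMap.zero_apply, smul_zero]
          · have : Lc i ≤ B := hB (by simpa using ⟨i, not_le.1 hi, rfl⟩)
            rw [hLc i _ (by omega), smul_zero]]
      simp
    intro m n
    rw [hadd]
    refine ext_apply fun γ z => eq_zero_of_translate (V := V) _ z ?_ γ
    obtain ⟨R, R', hR⟩ := translate_mulPow_jacobiDefect (hΦ a) (hΦ b) l z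
    have hg : (fun m n => translate V z (jacobiDefect a b Φ l m n)) =
        fun m n => (fun k => translate V z (jacobiDefect a b Φ l 0 k)) (m + n) := by
      funext m n; rw [hadd]
    have hinj : Function.Injective (seriesShift (X := P)) := fun v w h => funext fun γ => by
      simpa [seriesShift_apply] using congrFun h (γ - 1)
    refine congrFun (eq_zero_of_mulOne_iterate (g := fun k =>
      translate V z (jacobiDefect a b Φ l 0 k)) hinj (R + R')
      (fun k hk => by rw [hlarge k hk, map_zero]) (funext fun k => ?_)) (m + n)
    have h := hR 0 k
    rw [map_mulPow (T := seriesShift) _ fun x => translate_shift' z x, hg] at h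
    have h2 := congrFun (congrFun (mulPow_of_add seriesShift R R' fun k =>
      translate V z (jacobiDefect a b Φ l 0 k)) 0) k
    rw [zero_add] at h2
    exact h2.symm.trans h
  have hnonneg : ∀ l : ℕ, ∀ m n, jacobiDefect a b Φ l m n = 0 := by
    intro l
    induction l with
    | zero => exact jacobiDefect_zero a b Φ
    | succ l ih => intro m n; rw [Nat.cast_succ, hsucc, ih, ih, sub_zero]
  induction l using Int.induction_on generalizing m n with
  | zero => exact jacobiDefect_zero a b Φ m n
  | succ l _ => exact hnonneg (l + 1) m n
  | pred l ih => exact hdesc (-l - 1) (by simpa using ih) m n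

end TruncSeries
end VertexOperatorAlgebra

/-! ### Weak modules given by modes and weak submodules -/

/-- The eigencomponents of an element of an invariant subspace lie in the subspace. -/
theorem Module.End.eigencomponent_mem {M : Type*} [AddCommGroup M] [Module ℂ M]
    (f : Module.End ℂ M) {S : Submodule ℂ M} (hS : ∀ x ∈ S, f x ∈ S) {μ : ℂ} {x y : M}
    (hx : x ∈ f.eigenspace μ) (hy : y ∈ ⨆ (ν) (_ : ν ≠ μ), f.eigenspace ν) (hxy : x + y ∈ S) :
    x ∈ S := by
  -- In the quotient by `S` the images of `x` and `-y` agree, so that they vanish by the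
  -- independence of eigenspaces.
  let g : Module.End ℂ (M ⧸ S) := S.mapQ S f hS
  have hle : ∀ ν, (f.eigenspace ν).map S.mkQ ≤ g.eigenspace ν := by
    rintro ν _ ⟨z, hz, rfl⟩
    rw [Module.End.mem_eigenspace_iff]
    have hz' := Module.End.mem_eigenspace_iff.1 hz
    rw [← map_smul, ← hz']; rfl
  have hy' : S.mkQ y ∈ ⨆ (ν) (_ : ν ≠ μ), g.eigenspace ν := by
    have h : (⨆ (ν) (_ : ν ≠ μ), f.eigenspace ν).map S.mkQ ≤
        ⨆ (ν) (_ : ν ≠ μ), g.eigenspace ν := by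
      simp only [Submodule.map_iSup]
      exact iSup₂_mono fun ν _ => hle ν
    exact h ⟨y, hy, rfl⟩
  have hsum : S.mkQ x = -S.mkQ y := by
    rw [eq_neg_iff_add_eq_zero, ← map_add]
    exact (Submodule.Quotient.mk_eq_zero S).2 hxy
  have h0 : S.mkQ x = 0 := Submodule.disjoint_def.1 (g.eigenspaces_iSupIndep μ) _
    (hle μ ⟨x, hx, rfl⟩) (hsum ▸ Submodule.neg_mem _ hy')
  exact (Submodule.Quotient.mk_eq_zero S).1 h0

namespace VertexOperatorAlgebra

section

variable {V : Type u} [AddCommGroup V] [Module ℂ V] {M : Type v} [AddCommGroup M] [Module ℂ M]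

/-- The vertex operators with given modes. -/
def vertexOperatorOfModes (f : V →ₗ[ℂ] ℤ → Module.End ℂ M)
    (hf : ∀ a z, ∃ K : ℤ, ∀ n, K ≤ n → f a n z = 0) : V →ₗ[ℂ] VertexOperator ℂ M where
  toFun a := VertexOperator.of_coeff (fun n => f a (-n - 1)) fun z => by
    obtain ⟨K, hK⟩ := hf a z
    exact ⟨-K, fun n hn => not_lt.1 fun hlt => hn (hK (-n - 1) (by omega))⟩
  map_add' a b := HVertexOperator.coeff_inj (funext fun n =>
    congrFun (map_add f a b) (-n - 1))
  map_smul' c a := HVertexOperator.coeff_inj (funext fun n =>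
    congrFun (map_smul f c a) (-n - 1))

theorem ncoeff_vertexOperatorOfModes (f : V →ₗ[ℂ] ℤ → Module.End ℂ M)
    (hf : ∀ a z, ∃ K : ℤ, ∀ n, K ≤ n → f a n z = 0) (a : V) :
    (vertexOperatorOfModes f hf a).ncoeff = f a := by
  funext n
  have h : (vertexOperatorOfModes f hf a).ncoeff n = f a (-(-n - 1) - 1) := rfl
  rw [h, show -(-n - 1) - 1 = n by ring]

end

section

variable {V : Type u} [AddCommGroup V] [Module ℂ V] [VertexOperatorAlgebra V]

/-- A linear property of all the homogeneous elements of `V` holds on `V`. -/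
theorem homogeneous_induction {p : V → Prop} (h0 : p 0) (hadd : ∀ a b, p a → p b → p (a + b))
    (hmem : ∀ (n : ℤ) (a : V), a ∈ grading n → p a) (a : V) : p a := by
  have h : a ∈ ⨆ n, grading (V := V) n :=
    (isInternal_grading (V := V)).submodule_iSup_eq_top ▸ Submodule.mem_top
  exact Submodule.iSup_induction _ (motive := p) h hmem h0 hadd

section OfModes

variable {M : Type v} [AddCommGroup M] [Module ℂ M]

/-- A weak module, given by the modes of its vertex operators. -/
abbrev WeakModule.ofModes (f : V →ₗ[ℂ] ℤ → Module.End ℂ M)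
    (hf : ∀ a z, ∃ K : ℤ, ∀ n, K ≤ n → f a n z = 0)
    (hvac : ∀ n : ℤ, f vac n = if n = -1 then 1 else 0)
    (hder : ∀ (a : V) (n : ℤ), f (mode ω 0 a) n = (-(n : ℂ)) • f a (n - 1))
    (hjac : ∀ a b : V, JacobiIdentity (Γ := ℤ) (f a) (f a) (f b) fun k => f (mode a k b)) :
    WeakModule V M where
  YM := vertexOperatorOfModes f hf
  vac_modes n := by rw [ncoeff_vertexOperatorOfModes, hvac]
  derivative a n := by simp only [ncoeff_vertexOperatorOfModes, hder]
  jacobi a b := by simpa only [ncoeff_vertexOperatorOfModes] using hjac a b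

end OfModes

variable {M : Type v} [AddCommGroup M] [Module ℂ M] [WeakModule V M]

/-- A weak submodule, as a weak module. -/
abbrev IsWeakSubmodule.weakModule {S : Submodule ℂ M} (hS : IsWeakSubmodule V S) :
    WeakModule V S :=
  WeakModule.ofModes
    { toFun := fun a n => (act M a n).restrict fun z hz => hS a n z hz
      map_add' := fun a b => funext fun n => LinearMap.ext fun z =>
        Subtype.ext (LinearMap.congr_fun (act_add M a b n) (z : M))
      map_smul' := fun c a => funext fun n => LinearMap.ext fun z =>
        Subtype.ext (LinearMap.congr_fun (act_smul M c a n) (z : M)) }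
    (fun a z => by
      obtain ⟨K, hK⟩ := exists_act_eq_zero M a (z : M)
      exact ⟨K, fun n hn => Subtype.ext (hK n hn)⟩)
    (fun n => LinearMap.ext fun z => Subtype.ext <| by
      refine (LinearMap.congr_fun (act_vac M n) (z : M)).trans ?_
      split_ifs <;> rfl)
    (fun a n => LinearMap.ext fun z => Subtype.ext <|
      LinearMap.congr_fun (act_derivative M a n) (z : M))
    (fun a b l m n z => S.subtype_injective <| by
      have h := WeakModule.jacobi (M := M) a b l m n z
      simp only [map_sub, map_zsmul]
      erw [AddMonoidHom.map_finsum_of_injective S.subtype.toAddMonoidHom S.subtype_injective,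
        AddMonoidHom.map_finsum_of_injective S.subtype.toAddMonoidHom S.subtype_injective,
        AddMonoidHom.map_finsum_of_injective S.subtype.toAddMonoidHom S.subtype_injective]
      exact h)

theorem IsWeakSubmodule.coe_act {S : Submodule ℂ M} (hS : IsWeakSubmodule V S) (a : V) (n : ℤ)
    (z : S) :
    letI := hS.weakModule
    (act S a n z : M) = act M a n z := by
  let := hS.weakModule
  have h : act S a = _ := ncoeff_vertexOperatorOfModes (M := S) _ _ a
  rw [h]; rfl

/-- The subspace spanned by the vectors `a_n z` with `z ∈ E`. -/
def modeSpan (V : Type u) [AddCommGroup V] [Module ℂ V] [VertexOperatorAlgebra V]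
    [WeakModule V M] (E : Submodule ℂ M) : Submodule ℂ M :=
  Submodule.span ℂ {x | ∃ (a : V) (n : ℤ), ∃ z ∈ E, x = act M a n z}

theorem act_mem_modeSpan {E : Submodule ℂ M} (a : V) (n : ℤ) {z : M} (hz : z ∈ E) :
    act M a n z ∈ modeSpan V E := Submodule.subset_span ⟨a, n, z, hz, rfl⟩

theorem le_modeSpan (E : Submodule ℂ M) : E ≤ modeSpan V E := fun z hz => by
  have h := act_mem_modeSpan (vac : V) (-1) hz
  rwa [act_vac, if_pos rfl] at h

/-- By associativity, `a_p b_q z` is a combination of vectors `c_n z`. -/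
theorem act_act_mem_modeSpan {E : Submodule ℂ M} {z : M} (hz : z ∈ E) (a b : V) (p q : ℤ) :
    act M a p (act M b q z) ∈ modeSpan V E := by
  obtain ⟨L, hL⟩ := exists_act_eq_zero M b z
  obtain ⟨Ka, hKa⟩ := exists_act_eq_zero M a z
  have key : ∀ (k : ℕ) (q : ℤ), L ≤ q + k → ∀ p, act M a p (act M b q z) ∈ modeSpan V E := by
    intro k
    induction k with
    | zero => intro q hq p; rw [hL q (by simpa using hq), map_zero]; exact Submodule.zero_mem _
    | succ k ih =>
      intro q hq p
      -- For `m` with `a_{m + i} z = 0`, only the products `a_{p - i} b_{q + i} z` enter.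
      obtain ⟨M', hM'⟩ := TruncSeries.exists_nat_mode_eq_zero a b (p - Ka)
      obtain ⟨K, hK⟩ : ∃ K, K = M' + (L - q).toNat := ⟨_, rfl⟩
      have h := TruncSeries.jacobi_finite a b (p - Ka) Ka q z (K := K + 1)
        (fun i _ => hKa _ (by omega)) (fun i hi => hL _ (by omega))
        (fun i hi => hM' i (by omega))
      have h1 : ∀ i : ℕ, act M a (Ka + i) z = 0 := fun i => hKa _ (by omega)
      simp only [h1, map_zero, smul_zero, sub_zero, Finset.sum_sub_distrib] at h
      rw [Finset.sum_range_succ', sub_eq_zero] at h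
      simp only [altChoose_zero_right, one_smul, Nat.cast_zero, sub_zero, add_zero,
        add_sub_cancel] at h
      rw [eq_sub_iff_add_eq'.2 h]
      refine Submodule.sub_mem _ (Submodule.sum_mem _ fun i _ => ?_)
        (Submodule.sum_mem _ fun i _ => ?_)
      · exact zsmul_mem (act_mem_modeSpan _ _ hz) _
      · exact zsmul_mem (ih _ (by push_cast at hq ⊢; omega) _) _
  exact key (L - q).toNat q (by omega) p

theorem isWeakSubmodule_modeSpan (E : Submodule ℂ M) : IsWeakSubmodule V (modeSpan V E) := by
  intro a n z hz
  induction hz using Submodule.span_induction with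
  | mem x hx =>
    obtain ⟨b, m, z, hz, rfl⟩ := hx
    exact act_act_mem_modeSpan hz a b n m
  | zero => rw [map_zero]; exact Submodule.zero_mem _
  | add x y _ _ hx hy => rw [map_add]; exact Submodule.add_mem _ hx hy
  | smul c x _ hx => rw [map_smul]; exact Submodule.smul_mem _ c hx

theorem modeSpan_le {E S : Submodule ℂ M} (hS : IsWeakSubmodule V S) (hE : E ≤ S) :
    modeSpan V E ≤ S := by
  refine Submodule.span_le.2 ?_
  rintro _ ⟨a, n, z, hz, rfl⟩
  exact hS a n z (hE hz)

/-! ### Lowest weight weak modules -/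

theorem Lop_zero (z : M) : Lop V M 0 z = act M (ω : V) 1 z := rfl

/-- The mode `a_n` shifts the eigenvalues of `L(0)` by `wt a - n - 1`. -/
theorem Lop_zero_act {m : ℤ} {a : V} (ha : a ∈ grading m) (n : ℤ) {μ : ℂ} {z : M}
    (hz : z ∈ (Lop V M 0).eigenspace μ) :
    act M a n z ∈ (Lop V M 0).eigenspace (μ + (m - n - 1 : ℤ)) := by
  rw [Module.End.mem_eigenspace_iff, Lop_zero] at hz ⊢
  obtain ⟨K, hK⟩ := TruncSeries.exists_nat_mode_eq_zero' (ω : V) a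
  have h := act_commutator (ω : V) a 1 n z (K := K + 2) fun i hi => hK i (by omega)
  rw [Finset.sum_range_succ', Finset.sum_range_succ', Finset.sum_eq_zero, zero_add] at h
  · have hw : mode (ω : V) ((0 + 1 : ℕ) : ℤ) a = (m : ℂ) • a := weight m a ha
    rw [hz, hw, map_smul, act_smul, Nat.cast_zero, act_derivative] at h
    simp only [zero_add, Ring.choose_one_right, one_smul, Ring.choose_zero_right,
      LinearMap.smul_apply, sub_zero, Nat.cast_one, add_sub_cancel_left] at h
    rw [sub_eq_iff_eq_add.1 h, ← add_smul, ← add_smul]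
    congr 1
    push_cast; ring
  · intro j _
    have : Ring.choose (1 : ℤ) (j + 1 + 1) = 0 := by
      have := Ring.choose_natCast (R := ℤ) 1 (j + 1 + 1)
      rw [Nat.cast_one] at this
      rw [this, Nat.choose_eq_zero_of_lt (by omega), Nat.cast_zero]
    rw [this, zero_smul]

/-- The sum of the eigenspaces of `L(0)` for `h + 1, h + 2, …`. -/
def upperPart (V : Type u) [AddCommGroup V] [Module ℂ V] [VertexOperatorAlgebra V]
    (M : Type v) [AddCommGroup M] [Module ℂ M] [WeakModule V M] (h : ℂ) : Submodule ℂ M :=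
  ⨆ k : ℕ, (Lop V M 0).eigenspace (h + (k + 1 : ℕ))

theorem upperPart_le (h : ℂ) :
    upperPart V M h ≤ ⨆ (ν) (_ : ν ≠ h), (Lop V M 0).eigenspace ν := by
  refine iSup_le fun k => le_iSup₂_of_le (h + (k + 1 : ℕ)) (fun hk => ?_) le_rfl
  have : ((k + 1 : ℕ) : ℂ) = 0 := by simpa using hk
  exact absurd this (by exact_mod_cast Nat.succ_ne_zero k)

theorem iSup_eigenspace_le (h : ℂ) : (⨆ n : ℕ, (Lop V M 0).eigenspace (h + n)) ≤
    (Lop V M 0).eigenspace h ⊔ upperPart V M h := by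
  refine iSup_le fun n => ?_
  cases n with
  | zero => rw [Nat.cast_zero, add_zero]; exact le_sup_left
  | succ n => exact le_sup_of_le_right (le_iSup_of_le n le_rfl)

/-- A weak module generated by a `g(V)_0`-stable space `E` of vectors of weight `h` annihilated by
`g(V)_-` is a lowest weight weak module. -/
theorem isLowestWeight_of_generates {E : Submodule ℂ M} {h : ℂ}
    (hann : ∀ (m n : ℤ) (a : V), a ∈ grading m → m - n - 1 < 0 → ∀ z ∈ E, act M a n z = 0)
    (hgen : ∀ S : Submodule ℂ M, IsWeakSubmodule V S → E ≤ S → S = ⊤)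
    (hweight : ∀ z ∈ E, Lop V M 0 z = h • z)
    (hstable : ∀ (m : ℤ) (a : V), a ∈ grading m → ∀ z ∈ E, act M a (m - 1) z ∈ E) :
    IsLowestWeight V M E h := by
  have hEle : E ≤ (Lop V M 0).eigenspace h := fun z hz =>
    Module.End.mem_eigenspace_iff.2 (hweight z hz)
  have hle : (⊤ : Submodule ℂ M) ≤ E ⊔ upperPart V M h := by
    rw [← hgen _ (isWeakSubmodule_modeSpan E) (le_modeSpan E), modeSpan, Submodule.span_le]
    rintro _ ⟨a, n, z, hz, rfl⟩
    refine homogeneous_induction (p := fun a => act M a n z ∈ E ⊔ upperPart V M h) ?_ ?_ ?_ a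
    · simp
    · intro a b ha hb
      rw [act_add]; exact Submodule.add_mem _ ha hb
    · intro m a ha
      rcases lt_trichotomy (m - n - 1) 0 with hlt | heq | hgt
      · rw [hann m n a ha hlt z hz]; exact Submodule.zero_mem _
      · obtain rfl : n = m - 1 := by omega
        exact Submodule.mem_sup_left (hstable m a ha z hz)
      · refine Submodule.mem_sup_right ?_
        obtain ⟨k, hk⟩ : ∃ k : ℕ, m - n - 1 = ((k + 1 : ℕ) : ℤ) :=
          ⟨(m - n - 2).toNat, by omega⟩
        have h1 := Lop_zero_act ha n (hEle hz)
        rw [hk, Int.cast_natCast] at h1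
        exact Submodule.mem_iSup_of_mem k h1
  refine ⟨hann, hgen, top_unique (hle.trans (sup_le ?_ ?_)), le_antisymm ?_ hEle⟩
  · refine hEle.trans (le_iSup_of_le 0 ?_)
    rw [Nat.cast_zero, add_zero]
  · exact iSup_le fun k => le_iSup_of_le (k + 1) le_rfl
  · intro x hx
    obtain ⟨y, hy, w, hw, rfl⟩ := Submodule.mem_sup.1 (hle (Submodule.mem_top (x := x)))
    have hw0 : w = 0 := by
      have h1 := Submodule.sub_mem _ hx (hEle hy)
      rw [add_sub_cancel_left] at h1
      exact Submodule.disjoint_def.1 ((Lop V M 0).eigenspaces_iSupIndep h) w h1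
        (upperPart_le h hw)
    rwa [hw0, add_zero]

theorem IsLowestWeight.eigenspace_eq_bot {E : Submodule ℂ M} {h : ℂ}
    (hE : IsLowestWeight V M E h) {μ : ℂ} (hμ : ∀ n : ℕ, μ ≠ h + n) :
    (Lop V M 0).eigenspace μ = ⊥ := by
  have h1 := (Lop V M 0).eigenspaces_iSupIndep μ
  have h2 : (⨆ (ν) (_ : ν ≠ μ), (Lop V M 0).eigenspace ν) = ⊤ := by
    rw [eq_top_iff, ← hE.iSup_eigenspace]
    exact iSup_le fun n => le_iSup₂_of_le (h + n) (hμ n).symm le_rfl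
  rw [h2] at h1
  exact disjoint_top.1 h1

/-- The grading by `L(0)`-eigenspaces makes a lowest weight weak module `ℕ`-gradable. -/
theorem IsLowestWeight.isNGradableSub {E : Submodule ℂ M} {h : ℂ} (hE : IsLowestWeight V M E h) :
    IsNGradableSub V (⊤ : Submodule ℂ M) := by
  have hbot : ∀ k : ℤ, k < 0 → (Lop V M 0).eigenspace (h + k) = ⊥ := fun k hk =>
    hE.eigenspace_eq_bot fun n hn => by
      have : (k : ℂ) = ((n : ℤ) : ℂ) := by simpa using hn
      have := Int.cast_injective this
      omega
  refine ⟨fun k => (Lop V M 0).eigenspace (h + k), ?_, ?_, hbot, ?_⟩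
  · exact (Lop V M 0).eigenspaces_iSupIndep.comp fun k k' hkk' => by simpa using hkk'
  · rw [eq_top_iff, ← hE.iSup_eigenspace]
    exact iSup_le fun n => le_iSup_of_le (n : ℤ) (by simp only [Int.cast_natCast, le_refl])
  · intro m n k a ha z hz
    have h1 := Lop_zero_act ha n hz
    rwa [add_assoc, ← Int.cast_add, add_comm k] at h1

/-- A lowest weight weak module that is a sum of irreducible ones is irreducible, if a weak
submodule contains the lowest weight space as soon as it meets it: a summand which meets the lowest weight
space is everything, and summands which avoid it lie in the upper part. -/
theorem IsLowestWeight.isIrreducibleSub_top {E : Submodule ℂ M} {h : ℂ}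
    (hE : IsLowestWeight V M E h) (hne : E ≠ ⊥)
    (hirr : ∀ S : Submodule ℂ M, IsWeakSubmodule V S → S ⊓ E ≠ ⊥ → E ≤ S)
    {𝒮 : Set (Submodule ℂ M)} (h𝒮 : ∀ S ∈ 𝒮, IsIrreducibleSub V S) (htop : sSup 𝒮 = ⊤) :
    IsIrreducibleSub V (⊤ : Submodule ℂ M) := by
  by_cases hex : ∃ S ∈ 𝒮, S ⊓ E ≠ ⊥
  · obtain ⟨S, hS, hSE⟩ := hex
    rw [← hE.generates S (h𝒮 S hS).1 (hirr S (h𝒮 S hS).1 hSE)]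
    exact h𝒮 S hS
  · push Not at hex
    refine absurd ?_ hne
    have hle : ∀ S ∈ 𝒮, S ≤ upperPart V M h := by
      intro S hS x hx
      obtain ⟨y, hy, w, hw, rfl⟩ := Submodule.mem_sup.1
        (iSup_eigenspace_le h (hE.iSup_eigenspace ▸ Submodule.mem_top (x := x)))
      have hyS : y ∈ S := Module.End.eigencomponent_mem (Lop V M 0)
        (fun z hz => (h𝒮 S hS).1 ω 1 z hz) hy (upperPart_le h hw) hx
      have hy0 : y ∈ S ⊓ E := ⟨hyS, hE.eigenspace_eq ▸ hy⟩
      rw [hex S hS, Submodule.mem_bot] at hy0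
      rwa [hy0, zero_add]
    have hup : upperPart V M h = ⊤ := top_unique (htop ▸ sSup_le hle)
    have h1 := ((Lop V M 0).eigenspaces_iSupIndep h).mono_right (upperPart_le (M := M) h)
    rw [hup, hE.eigenspace_eq] at h1
    exact disjoint_top.1 h1

end

end VertexOperatorAlgebra

namespace VertexOperatorAlgebra

variable {V : Type u} [AddCommGroup V] [Module ℂ V] [VertexOperatorAlgebra V]

/-! ### The weak module of generalized intertwining operators -/

section GenIntertwining

variable {N : Type v} {P : Type w} [AddCommGroup N] [Module ℂ N] [AddCommGroup P] [Module ℂ P]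
  [WeakModule V N] [WeakModule V P]

namespace TruncSeries

/-- The mode `a_n` on generalized intertwining operators. -/
def genMode (n : ℤ) (a : V) : Module.End ℂ (genIntertwining V N P) :=
  (op a n 0).restrict fun _ hΦ => op_mem_genIntertwining hΦ a n

instance : WeakModule V (genIntertwining V N P) :=
  WeakModule.ofModes
    { toFun := fun a n => genMode n a
      map_add' := fun a b => funext fun n => LinearMap.ext fun Φ =>
        Subtype.ext (LinearMap.congr_fun (op_add a b n 0) Φ.1)
      map_smul' := fun c a => funext fun n => LinearMap.ext fun Φ =>
        Subtype.ext (LinearMap.congr_fun (op_smul c a n 0) Φ.1) }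
    (fun a Φ => by
      obtain ⟨L, hL⟩ := Φ.2.1 a
      exact ⟨L, fun n hn => Subtype.ext (hL n hn 0)⟩)
    (fun n => LinearMap.ext fun Φ => Subtype.ext <| by
      refine (op_vac n Φ.1).trans ?_
      split_ifs <;> rfl)
    (fun a n => LinearMap.ext fun Φ => Subtype.ext (op_derivative a n Φ.1))
    (fun a b l m n Φ => (genIntertwining V N P).subtype_injective <| by
      have h := jacobiDefect_eq_zero Φ.2.1 a b l m n
      rw [jacobiDefect, sub_eq_zero] at h
      simp only [map_sub, map_zsmul]
      erw [AddMonoidHom.map_finsum_of_injective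
          (genIntertwining V N P).subtype.toAddMonoidHom (Submodule.subtype_injective _),
        AddMonoidHom.map_finsum_of_injective
          (genIntertwining V N P).subtype.toAddMonoidHom (Submodule.subtype_injective _),
        AddMonoidHom.map_finsum_of_injective
          (genIntertwining V N P).subtype.toAddMonoidHom (Submodule.subtype_injective _)]
      exact h)

theorem coe_act_genIntertwining (a : V) (n : ℤ) (Φ : genIntertwining V N P) :
    (act (genIntertwining V N P) a n Φ : TruncSeries N P) = op a n 0 Φ := by
  have h : act (genIntertwining V N P) a = _ :=
    ncoeff_vertexOperatorOfModes (M := genIntertwining V N P) _ _ a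
  rw [h]; rfl

end TruncSeries

open TruncSeries

/-- A homomorphism into generalized intertwining operators, evaluated as a series, is an
intertwining operator. -/
theorem isIntertwiningOperator_of_hom {W : Type*} [AddCommGroup W] [Module ℂ W] [WeakModule V W]
    (f : W →ₗ[ℂ] genIntertwining V N P)
    (hf : ∀ (a : V) (n : ℤ) (w : W), f (act W a n w) = act (genIntertwining V N P) a n (f w)) :
    IsIntertwiningOperator V ((TruncSeries N P).subtype ∘ₗ
      (genIntertwining V N P).subtype ∘ₗ f) where
  truncation w := (f w).1.2
  derivative w := by
    have h : f (Lop V W (-1) w) = _ := hf ω 0 w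
    change (f (Lop V W (-1) w)).1.1 = seriesDeriv (f w).1.1
    rw [h, coe_act_genIntertwining, (f w).2.2]
    rfl
  jacobi a w := by
    have h := jacobiIdentity_of_isLocalWith ((f w).2.1 a)
    have e : (fun k => ((TruncSeries N P).subtype ∘ₗ (genIntertwining V N P).subtype ∘ₗ f)
        (act W a k w)) = fun k => (op a k 0 (f w).1).1 := by
      funext k
      change (f (act W a k w)).1.1 = _
      rw [hf, coe_act_genIntertwining]
    rw [e]
    exact h

/-- An intertwining operator is determined by its values on a generating subspace. -/
theorem IsIntertwiningOperator.ext_of_generates {W : Type*} [AddCommGroup W] [Module ℂ W]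
    [WeakModule V W] {I J : W →ₗ[ℂ] HomSeries N P} (hI : IsIntertwiningOperator V I)
    (hJ : IsIntertwiningOperator V J) {E : Submodule ℂ W}
    (hgen : ∀ S : Submodule ℂ W, IsWeakSubmodule V S → E ≤ S → S = ⊤)
    (hE : ∀ w ∈ E, I w = J w) : I = J := by
  have hmode : ∀ {I : W →ₗ[ℂ] HomSeries N P}, IsIntertwiningOperator V I →
      ∀ (a : V) (w : W) (k : ℤ) (γ : ℂ) (z : N), I (act W a k w) γ z =
        (∑ᶠ i : ℕ, ((-1 : ℤ) ^ i * Ring.choose k i) • act P a (0 + k - i) (I w (γ + i) z))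
        - (k.negOnePow : ℤ) •
          (∑ᶠ i : ℕ, ((-1 : ℤ) ^ i * Ring.choose k i) • I w (γ + k - i) (act N a (0 + i) z)) := by
    intro I hI a w k γ z
    rw [hI.jacobi a w k 0 γ z, finsum_eq_sum_range (K := 1) fun i hi => by
      obtain ⟨j, rfl⟩ : ∃ j, i = j + 1 := ⟨i - 1, by omega⟩
      rw [Ring.choose_zero_succ, zero_smul]]
    simp
  have h := hgen (LinearMap.eqLocus I J) (fun a n w hw => ?_) hE
  · exact LinearMap.ext fun w => by
      have : w ∈ LinearMap.eqLocus I J := h ▸ Submodule.mem_top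
      exact this
  · rw [LinearMap.mem_eqLocus] at hw ⊢
    refine funext fun γ => LinearMap.ext fun z => ?_
    rw [hmode hI, hmode hJ, hw]

/-- The bracket formula says that `ω_0 = L(-1)` acts by the formal derivative. -/
theorem TruncSeries.op_omega_zero_eq_deriv {Φ : TruncSeries N P} (h : LBracketFormula V Φ.1) :
    op (ω : V) 0 0 Φ = deriv Φ :=
  ext_apply fun γ z => by
    rw [op_coeff, left_apply, right_apply, expandMul_zero, expandMul_zero, Int.negOnePow_zero,
      Units.val_one, one_smul]
    exact LinearMap.congr_fun (h γ) z

section WeightRelation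

variable {U : Type*} [AddCommGroup U] [Module ℂ U] [LieRingModule (GZero V) U]
  {I₀ : U →ₗ[ℂ] HomSeries N P}

/-- The weight relation says that `a(wt a - 1)` acts on `I₀(y, x)` by the given action on `y`, and
determines the coefficients of all `x₁^{-p-1}`. -/
theorem WeightRelation.op_eq (hrel : WeightRelation V I₀) (htrunc : ∀ y, IsTruncated (I₀ y))
    {n : ℤ} {a : V} (ha : a ∈ grading n) (y : U) (p : ℤ) (γ : ℂ) :
    (op a (n - 1) p ⟨I₀ y, htrunc y⟩ : TruncSeries N P).1 γ = I₀ ⁅GZero.gen n a ha, y⁆ (γ + p) :=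
  LinearMap.ext fun z => hrel n a ha y p γ z

/-- `(x₁ - x₂) x₁⁻¹ δ(x₂/x₁) = 0` turns the weight relation into locality of order `wt a`. -/
theorem WeightRelation.op_eq_zero (hrel : WeightRelation V I₀)
    (htrunc : ∀ y, IsTruncated (I₀ y)) {n : ℤ} {a : V} (ha : a ∈ grading n) (y : U) {l : ℤ}
    (hl : n ≤ l) (p : ℤ) : op a l p (⟨I₀ y, htrunc y⟩ : TruncSeries N P) = 0 := by
  induction l, hl using Int.leInduction generalizing p with
  | base =>
    rw [show n = n - 1 + 1 by ring, op_succ]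
    refine Subtype.ext (funext fun γ => ?_)
    have h1 := hrel.op_eq htrunc ha y (p + 1) γ
    have h2 := hrel.op_eq htrunc ha y p (γ + 1)
    change (op a (n - 1) (p + 1) _ : TruncSeries N P).1 γ -
      (op a (n - 1) p _ : TruncSeries N P).1 (γ + 1) = 0
    rw [h1, h2, sub_eq_zero]
    rw [show γ + ((p + 1 : ℤ) : ℂ) = γ + 1 + p by push_cast; ring]
  | succ l hl ih => rw [op_succ, ih, ih, map_zero, sub_zero]

theorem WeightRelation.isLocalWith (hrel : WeightRelation V I₀)
    (htrunc : ∀ y, IsTruncated (I₀ y)) (y : U) (a : V) :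
    IsLocalWith a (⟨I₀ y, htrunc y⟩ : TruncSeries N P) := by
  refine homogeneous_induction (p := fun a => IsLocalWith a _) ?_ ?_ ?_ a
  · exact ⟨0, fun l _ m => by rw [op_zero]; rfl⟩
  · rintro a b ⟨L, hL⟩ ⟨L', hL'⟩
    exact ⟨max L L', fun l hl m => by
      rw [op_add, LinearMap.add_apply, hL l (le_trans (le_max_left _ _) hl),
        hL' l (le_trans (le_max_right _ _) hl), add_zero]⟩
  · intro n a ha
    exact ⟨n, fun l hl m => hrel.op_eq_zero htrunc ha y hl m⟩

end WeightRelation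

end GenIntertwining

/-- A subspace of a `g(V)_0`-module stable under the generators `a(wt a - 1)` is a submodule. -/
theorem lie_mem_of_gen_mem {U : Type*} [AddCommGroup U] [Module ℂ U] [LieRingModule (GZero V) U]
    [LieModule ℂ (GZero V) U] {K : Submodule ℂ U}
    (hK : ∀ (n : ℤ) (a : V) (ha : a ∈ grading n), ∀ y ∈ K, ⁅GZero.gen n a ha, y⁆ ∈ K)
    (x : GZero V) {y : U} (hy : y ∈ K) : ⁅x, y⁆ ∈ K := by
  obtain ⟨x, hx⟩ := x
  have h : ∀ y ∈ K, ⁅(⟨x, hx⟩ : GZero V), y⁆ ∈ K := by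
    refine LieSubalgebra.lieSpan_induction ℂ
      (p := fun x hx => ∀ y ∈ K, ⁅(⟨x, hx⟩ : GZero V), y⁆ ∈ K) ?_ ?_ ?_ ?_ ?_ hx
    · rintro _ ⟨n, a, ha, rfl⟩ y hy
      exact hK n a ha y hy
    · intro y _
      have : (⟨0, LieSubalgebra.zero_mem _⟩ : GZero V) = 0 := rfl
      rw [this, zero_lie]; exact K.zero_mem
    · intro x x' hx hx' h h' y hy
      have : (⟨x + x', LieSubalgebra.add_mem _ hx hx'⟩ : GZero V) = ⟨x, hx⟩ + ⟨x', hx'⟩ := rfl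
      rw [this, add_lie]; exact K.add_mem (h y hy) (h' y hy)
    · intro c x hx h y hy
      have : (⟨c • x, LieSubalgebra.smul_mem _ c hx⟩ : GZero V) = c • ⟨x, hx⟩ := rfl
      rw [this, smul_lie]; exact K.smul_mem c (h y hy)
    · intro x x' hx hx' h h' y hy
      have : (⟨⁅x, x'⁆, LieSubalgebra.lie_mem _ hx hx'⟩ : GZero V) =
        ⁅(⟨x, hx⟩ : GZero V), (⟨x', hx'⟩ : GZero V)⁆ := rfl
      rw [this, lie_lie]; exact K.sub_mem (h _ (h' y hy)) (h' _ (h y hy))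
  exact h y hy

/-- A copy `ι₀(U)` of a `g(V)_0`-module inside a weak module `M`, annihilated by `g(V)_-` and of
weight `h`, generates a lowest weight weak module; `f` is its inclusion into `M`. -/
theorem exists_isLowestWeight {M : Type v} [AddCommGroup M] [Module ℂ M] [WeakModule V M]
    {U : Type*} [AddCommGroup U] [Module ℂ U] [LieRingModule (GZero V) U]
    {h : ℂ} (ι₀ : U →ₗ[ℂ] M)
    (hgen : ∀ (n : ℤ) (a : V) (ha : a ∈ grading n) (y : U),
      ι₀ ⁅GZero.gen n a ha, y⁆ = act M a (n - 1) (ι₀ y))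
    (hann : ∀ (m n : ℤ) (a : V), a ∈ grading m → m - n - 1 < 0 → ∀ y, act M a n (ι₀ y) = 0)
    (hL0 : ∀ y : U, ⁅GZero.L0 V, y⁆ = h • y) :
    ∃ (W : Type v) (_ : AddCommGroup W) (_ : Module ℂ W) (_ : WeakModule V W)
      (ι : U →ₗ[ℂ] W) (f : W →ₗ[ℂ] M),
      (∀ (a : V) (n : ℤ) (w : W), f (act W a n w) = act M a n (f w)) ∧
      (∀ y, f (ι y) = ι₀ y) ∧
      (∀ (n : ℤ) (a : V) (ha : a ∈ grading n) (y : U),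
        ι ⁅GZero.gen n a ha, y⁆ = act W a (n - 1) (ι y)) ∧
      IsLowestWeight V W (LinearMap.range ι) h := by
  have hS := isWeakSubmodule_modeSpan (V := V) (LinearMap.range ι₀)
  let S := modeSpan V (LinearMap.range ι₀)
  let : WeakModule V S := hS.weakModule
  let ι : U →ₗ[ℂ] S := ι₀.codRestrict S fun y => le_modeSpan _ (LinearMap.mem_range_self ι₀ y)
  have hact : ∀ (a : V) (n : ℤ) (w : S), S.subtype (act S a n w) = act M a n (S.subtype w) :=
    hS.coe_act
  have hgen' : ∀ (n : ℤ) (a : V) (ha : a ∈ grading n) (y : U),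
      ι ⁅GZero.gen n a ha, y⁆ = act S a (n - 1) (ι y) := fun n a ha y =>
    Subtype.ext ((hgen n a ha y).trans (hact a (n - 1) (ι y)).symm)
  refine ⟨S, inferInstance, inferInstance, inferInstance, ι, S.subtype, hact, fun y => rfl, hgen',
    isLowestWeight_of_generates ?_ ?_ ?_ ?_⟩
  · rintro m n a ha hlt _ ⟨y, rfl⟩
    exact Subtype.ext ((hact a n (ι y)).trans (hann m n a ha hlt y))
  · intro T hT hle
    have hmap : IsWeakSubmodule V (T.map S.subtype) := by
      rintro a n _ ⟨w, hw, rfl⟩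
      exact ⟨act S a n w, hT a n w hw, hact a n w⟩
    have hSle : S ≤ T.map S.subtype := modeSpan_le hmap (by
      rintro _ ⟨y, rfl⟩
      exact ⟨ι y, hle (LinearMap.mem_range_self ι y), rfl⟩)
    refine eq_top_iff.2 fun w _ => ?_
    obtain ⟨w', hw', hww'⟩ := hSle w.2
    rwa [← Subtype.ext hww']
  · rintro _ ⟨y, rfl⟩
    have h1 := hgen' 2 ω (ω_mem_grading V) y
    have h2 : ⁅GZero.gen 2 ω (ω_mem_grading V), y⁆ = h • y := hL0 y
    rw [h2, map_smul] at h1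
    exact h1.symm
  · rintro m a ha _ ⟨y, rfl⟩
    exact ⟨⁅GZero.gen m a ha, y⁆, hgen' m a ha y⟩

/-- The irreducibility statement, for a lowest weight weak module whose lowest weight subspace is
an irreducible `g(V)_0`-module. -/
theorem IsLowestWeight.isIrreducibleSub_of_isRational {W : Type u} [AddCommGroup W] [Module ℂ W]
    [WeakModule V W] {U : Type*} [AddCommGroup U] [Module ℂ U] [LieRingModule (GZero V) U]
    [LieModule ℂ (GZero V) U] {ι : U →ₗ[ℂ] W} (hι : Function.Injective ι)
    (hgen : ∀ (n : ℤ) (a : V) (ha : a ∈ grading n) (y : U),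
      ι ⁅GZero.gen n a ha, y⁆ = act W a (n - 1) (ι y))
    {h : ℂ} (hW : IsLowestWeight V W (LinearMap.range ι) h) (hV : IsRational V)
    (hU : LieModule.IsIrreducible ℂ (GZero V) U) :
    IsIrreducibleSub V (⊤ : Submodule ℂ W) := by
  obtain ⟨𝒮, h𝒮, -, htop⟩ := hV W hW.isNGradableSub
  have hnt : Nontrivial U := (LieSubmodule.nontrivial_iff ℂ (GZero V) U).1 inferInstance
  refine hW.isIrreducibleSub_top ?_ ?_ (fun S hS => (h𝒮 S hS).1) htop
  · obtain ⟨y, hy⟩ := exists_ne (0 : U)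
    intro hbot
    have : ι y ∈ (⊥ : Submodule ℂ W) := hbot ▸ LinearMap.mem_range_self ι y
    exact hy (hι (by rw [map_zero]; exact this))
  · intro S hS hne
    let K : LieSubmodule ℂ (GZero V) U :=
      { S.comap ι with
        lie_mem := fun {x y} hy => lie_mem_of_gen_mem (K := S.comap ι)
          (fun n a ha y hy => by
            rw [Submodule.mem_comap, hgen]; exact hS a (n - 1) _ hy) x hy }
    obtain ⟨w, ⟨hwS, y, rfl⟩, hw0⟩ := Submodule.exists_mem_ne_zero_of_ne_bot hne
    have hK : K ≠ ⊥ := fun hbot => by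
      have : y ∈ K := hwS
      rw [hbot, LieSubmodule.mem_bot] at this
      exact hw0 (by rw [this, map_zero])
    have htop : K = ⊤ := (IsSimpleOrder.eq_bot_or_eq_top K).resolve_left hK
    rintro _ ⟨y, rfl⟩
    have : y ∈ K := htop ▸ LieSubmodule.mem_top y
    exact this

end VertexOperatorAlgebra

end

open VertexOperatorAlgebra in
theorem theorem4p12 {V : Type u} [AddCommGroup V] [Module ℂ V] [VertexOperatorAlgebra V]
    {W₁ W₂ : Type u} [AddCommGroup W₁] [Module ℂ W₁] [WeakModule V W₁]
    [AddCommGroup W₂] [Module ℂ W₂] [WeakModule V W₂]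
    (hW₁ : IsVModule V W₁) (hW₂ : IsVModule V W₂)
    {U : Type u} [AddCommGroup U] [Module ℂ U]
    [LieRingModule (GZero V) U] [LieModule ℂ (GZero V) U]
    (h : ℂ) (hL0 : ∀ y : U, ⁅GZero.L0 V, y⁆ = h • y)
    (I₀ : U →ₗ[ℂ] HomSeries W₁ W₂) (hinj : Function.Injective I₀)
    (htrunc : ∀ y : U, IsTruncated (I₀ y))
    (hbracket : ∀ y : U, LBracketFormula V (I₀ y))
    (hrel : WeightRelation V I₀) :
    ∃ (W : Type u) (_ : AddCommGroup W) (_ : Module ℂ W) (_ : WeakModule V W) (ι : U →ₗ[ℂ] W),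
      Function.Injective ι ∧
      (∀ (n : ℤ) (a : V) (ha : a ∈ grading n) (y : U),
        ι ⁅GZero.gen n a ha, y⁆ = act W a (n - 1) (ι y)) ∧
      IsLowestWeight V W (LinearMap.range ι) h ∧
      (∃! I : W →ₗ[ℂ] HomSeries W₁ W₂,
        IsIntertwiningOperator V I ∧ ∀ y : U, I (ι y) = I₀ y) ∧
      (IsRational V → LieModule.IsIrreducible ℂ (GZero V) U →
        IsIrreducibleSub V (⊤ : Submodule ℂ W)) := by
  let ι₀ : U →ₗ[ℂ] TruncSeries.genIntertwining V W₁ W₂ :=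
    (I₀.codRestrict (TruncSeries W₁ W₂) htrunc).codRestrict _ fun y =>
      ⟨hrel.isLocalWith htrunc y, TruncSeries.op_omega_zero_eq_deriv (hbracket y)⟩
  have hact₀ : ∀ (a : V) (n : ℤ) (y : U),
      (act (TruncSeries.genIntertwining V W₁ W₂) a n (ι₀ y) : TruncSeries W₁ W₂) =
        TruncSeries.op a n 0 ⟨I₀ y, htrunc y⟩ := fun a n y =>
    TruncSeries.coe_act_genIntertwining a n (ι₀ y)
  obtain ⟨W, _, _, _, ι, f, hf, hfι, hgen, hW⟩ :=
    exists_isLowestWeight (M := TruncSeries.genIntertwining V W₁ W₂) ι₀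
      (fun n a ha y => Subtype.ext <| Subtype.ext <| funext fun γ => by
        rw [hact₀, hrel.op_eq htrunc ha y 0 γ, Int.cast_zero, add_zero]
        rfl)
      (fun m n a ha hlt y => by
        rw [← Submodule.coe_eq_zero, hact₀]
        exact hrel.op_eq_zero htrunc ha y (by omega) 0)
      hL0
  have hι : Function.Injective ι := fun y y' hyy' => hinj <| by
    have h1 := congrArg f hyy'
    rw [hfι, hfι] at h1
    exact congrArg (fun w => w.1.1) h1
  have hI := isIntertwiningOperator_of_hom f hf
  refine ⟨W, inferInstance, inferInstance, inferInstance, ι, hι, hgen, hW, ?_,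
    hW.isIrreducibleSub_of_isRational hι hgen⟩
  refine ⟨_, ⟨hI, fun y => congrArg (fun w => w.1.1) (hfι y)⟩,
    fun J hJ => hJ.1.ext_of_generates hI hW.generates ?_⟩
  rintro _ ⟨y, rfl⟩
  exact (hJ.2 y).trans (congrArg (fun w => w.1.1) (hfι y)).symm
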